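/- Let $\Omega\subseteq\mathbb{R}^3$ be an arbitrary open set (no boundedness, topological or boundary-regularity assumption). Let $\mathring{\operatorname{curl}}$ be the closure in $L^2(\Omega,\mathbb{C}^3)$ of the classical $\operatorname{curl}$ on $C^1$ vector fields with compact support in $\Omega$, let $\operatorname{curl}:=\mathring{\operatorname{curl}}^*$, and in $L^2(\Omega,\mathbb{C}^6)=L^2(\Omega,\mathbb{C}^3)\times L^2(\Omega,\mathbb{C}^3)$ let $$A:=\begin{pmatrix}0&-\operatorname{curl}\\ \mathring{\operatorname{curl}}&0\end{pmatrix},\qquad D(A)=D(\mathring{\operatorname{curl}})\times D(\operatorname{curl}).$$ Then $A$ is skew-selfadjoint, i.e. densely defined with $A^*=-A$. For $\rho>0$ and a Hilbert space $H$ let $H_\rho(\mathbb{R},H)$ be the Hilbert space of (classes of) $H$-valued functions on $\mathbb{R}$ with inner product $\langle\varphi\,|\,\psi\rangle_\rho=\int_{\mathbb{R}}\langle\varphi(t)\,|\,\psi(t)\rangle_H\,e^{-2\rho t}\,dt$, and let $\partial_0$ be the closure in $H_\rho(\mathbb{R},H)$ of $\frac{d}{dt}$ on $C^1$ functions $\mathbb{R}\to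 H$ with compact support. Now let $H=L^2(\Omega,\mathbb{C}^6)$; operators in $H$ act in $H_\rho(\mathbb{R},H)$ pointwise in time, and for bounded $M,N$ on $H$ the operator $\partial_0M+N+A$ has the domain $\{u: Mu\in D(\partial_0),\ u\in D(A)\}$. Let $\rho>0$ and $c>0$, let $\epsilon_s,\mu_s,\sigma_s$ be bounded linear operators on $L^2(\Omega,\mathbb{C}^3)$ for $s\in[0,1)$, and put $$M_s=\begin{pmatrix}\epsilon_s&0\\0&\mu_s\end{pmatrix},\qquad N_s=\begin{pmatrix}\sigma_s&0\\0&0\end{pmatrix}.$$ Assume that $M_s$ is selfadjoint and $\rho M_s+\Re N_s\ge c$ for all $s\in[0,1)$, and that $M_s\to M_0$ and $N_s\to N_0$ strongly in $L^2(\Omega,\mathbb{C}^6)$ as $s\to0+$. Then for every $s\in[0,1)$ the operator $\partial_0M_s+N_s+A$ is closable in $H_\rho(\mathbb{R},L^2(\Omega,\mathbb{C}^6))$, its closure has an everywhere defined bounded inverse with $$\Big\|\big(\overline{\partial_0M_s+N_s+A}\big)^{-1}\Big\|\le\frac1c,$$ and the solution operators converge strongly: for every $F\in H_\rho(\mathbb{R},L^2(\Omega,\mathbb{C}^6))$,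 $$\big(\overline{\partial_0M_s+N_s+A}\big)^{-1}F\longrightarrow\big(\overline{\partial_0M_0+N_0+A}\big)^{-1}F\qquad(s\to0+).$$ The operator $\epsilon_0$ may vanish, wholly or on a part of $\Omega$ (the eddy current model), as long as the positivity condition holds. The same conclusions hold, more generally, for arbitrary bounded linear operators $M_s=M_s^*$ and $N_s$ ($s\in[0,1)$) on $L^2(\Omega,\mathbb{C}^6)$ with $\rho M_s+\Re N_s\ge c$ for all $s\in[0,1)$ and $M_s\to M_0$, $N_s\to N_0$ strongly as $s\to0+$. -/

import Mathlib

open MeasureTheory Filter Topology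
open scoped LinearPMap

noncomputable section

namespace EddyCurrent

/-! ### Unbounded operators in Hilbert spaces -/

section Operators

variable {X Y : Type*} [NormedAddCommGroup X] [InnerProductSpace ℂ X]
  [NormedAddCommGroup Y] [InnerProductSpace ℂ Y]

/-- A densely defined operator `A` is skew-selfadjoint if `A* = -A`. -/
def IsSkewSelfAdjoint [CompleteSpace X] (A : X →ₗ.[ℂ] X) : Prop :=
  Dense (A.domain : Set X) ∧ A† = -A

/-- The product `T M` of a bounded operator `M` and an unbounded operator `T`, on its natural
domain `{x | M x ∈ D(T)}`. -/
def compBounded (T : Y →ₗ.[ℂ] Y) (M : X →L[ℂ] Y) : X →ₗ.[ℂ] Y where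
  domain := T.domain.comap (M : X →ₗ[ℂ] Y)
  toFun := T.toFun.comp
    (((M : X →ₗ[ℂ] Y).comp (T.domain.comap (M : X →ₗ[ℂ] Y)).subtype).codRestrict T.domain
      fun x => x.2)

/-- The everywhere defined bounded operator `S` is the inverse `T⁻¹` of the (unbounded)
operator `T`, i.e. the graph of `S` is the flipped graph of `T`. Equivalently, `T : D(T) → X` is a
bijection, and `S` is its inverse. -/
def IsBoundedInverse (T : X →ₗ.[ℂ] X) (S : X →L[ℂ] X) : Prop :=
  ∀ u f : X, (u, f) ∈ T.graph ↔ S f = u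

/-- The off-diagonal block operator `(E, H) ↦ (-C* H, C E)` in the Hilbert space `X × X`, with
domain `D(C) × D(C*)`. -/
def skewBlock [CompleteSpace X] (C : X →ₗ.[ℂ] X) :
    WithLp 2 (X × X) →ₗ.[ℂ] WithLp 2 (X × X) where
  domain :=
    { carrier := {p | p.fst ∈ C.domain ∧ p.snd ∈ C†.domain}
      add_mem' := fun ha hb => ⟨C.domain.add_mem ha.1 hb.1, C†.domain.add_mem ha.2 hb.2⟩
      zero_mem' := ⟨C.domain.zero_mem, C†.domain.zero_mem⟩
      smul_mem' := fun a _ hx => ⟨C.domain.smul_mem a hx.1, C†.domain.smul_mem a hx.2⟩ }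
  toFun :=
    { toFun := fun p => WithLp.toLp 2 (-(C† ⟨p.1.snd, p.2.2⟩), C ⟨p.1.fst, p.2.1⟩)
      map_add' := fun p q => by
        have h1 := C†.map_add ⟨p.1.snd, p.2.2⟩ ⟨q.1.snd, q.2.2⟩
        have h2 := C.map_add ⟨p.1.fst, p.2.1⟩ ⟨q.1.fst, q.2.1⟩
        rw [← WithLp.toLp_add, Prod.mk_add_mk, ← neg_add, ← h1, ← h2]
        rfl
      map_smul' := fun a p => by
        have h1 := C†.map_smul a ⟨p.1.snd, p.2.2⟩
        have h2 := C.map_smul a ⟨p.1.fst, p.2.1⟩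
        rw [RingHom.id_apply, ← WithLp.toLp_smul, Prod.smul_mk, smul_neg, ← h1, ← h2]
        rfl }

/-- The block-diagonal bounded operator `diag(P, Q)` in the Hilbert space `X × X`. -/
def blockDiag (P Q : X →L[ℂ] X) : WithLp 2 (X × X) →L[ℂ] WithLp 2 (X × X) :=
  ((WithLp.prodContinuousLinearEquiv 2 ℂ X X).symm : X × X →L[ℂ] WithLp 2 (X × X)) ∘L
    (P.prodMap Q) ∘L
      ((WithLp.prodContinuousLinearEquiv 2 ℂ X X) : WithLp 2 (X × X) →L[ℂ] X × X)

/-- The operator inequality `Re B ≥ c`, as an inequality of quadratic forms. -/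
def ReGE (B : X →L[ℂ] X) (c : ℝ) : Prop :=
  ∀ x : X, c * ‖x‖ ^ 2 ≤ (inner ℂ x (B x)).re

end Operators

/-! ### The weighted space `H_ρ(ℝ, H)` and the time derivative -/

/-- The measure `exp(-2ρt) dt` on the time axis. -/
def timeMeasure (ρ : ℝ) : Measure ℝ :=
  volume.withDensity fun t => ENNReal.ofReal (Real.exp (-2 * ρ * t))

section Time

variable (ρ : ℝ) (H : Type*) [NormedAddCommGroup H] [InnerProductSpace ℂ H]

/-- `H_ρ(ℝ, H)`: the Hilbert space of (classes of) `H`-valued functions `u` on `ℝ` with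
`∫ ‖u(t)‖² exp(-2ρt) dt < ∞`. -/
abbrev HRho : Type _ := Lp H 2 (timeMeasure ρ)

/-- The graph of `d/dt` on compactly supported `C¹` functions `ℝ → H`, as a subspace of
`H_ρ(ℝ, H) × H_ρ(ℝ, H)`. -/
def timeDerivGraph : Submodule ℂ (HRho ρ H × HRho ρ H) where
  carrier := {p | ∃ φ : ℝ → H, ContDiff ℝ 1 φ ∧ HasCompactSupport φ ∧
    p.1 =ᵐ[timeMeasure ρ] φ ∧ p.2 =ᵐ[timeMeasure ρ] deriv φ}
  zero_mem' := ⟨0, contDiff_zero_fun, HasCompactSupport.zero, Lp.coeFn_zero _ _ _, by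
    have h : deriv (0 : ℝ → H) = 0 := by ext t; simp
    rw [h]; exact Lp.coeFn_zero _ _ _⟩
  add_mem' := by
    rintro p q ⟨φ, hφ, hφc, h1, h2⟩ ⟨ψ, hψ, hψc, h3, h4⟩
    refine ⟨φ + ψ, hφ.add hψ, hφc.add hψc, (Lp.coeFn_add _ _).trans (h1.add h3), ?_⟩
    have h : deriv (φ + ψ) = deriv φ + deriv ψ := by
      ext t
      exact deriv_add (hφ.differentiable one_ne_zero t) (hψ.differentiable one_ne_zero t)
    rw [h]; exact (Lp.coeFn_add _ _).trans (h2.add h4)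
  smul_mem' := by
    rintro a p ⟨φ, hφ, hφc, h1, h2⟩
    refine ⟨a • φ, contDiff_const.smul hφ, hφc.smul_left (f := fun _ => a),
      (Lp.coeFn_smul _ _).trans (h1.const_smul a), ?_⟩
    have h : deriv (a • φ) = a • deriv φ := by
      ext t
      exact deriv_const_smul a (hφ.differentiable one_ne_zero t)
    rw [h]; exact (Lp.coeFn_smul _ _).trans (h2.const_smul a)

/-- The time derivative `∂₀`: the closure in `H_ρ(ℝ, H)` of `d/dt` on compactly supported `C¹`
functions `ℝ → H`. -/
def timeDeriv : HRho ρ H →ₗ.[ℂ] HRho ρ H :=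
  (timeDerivGraph ρ H).toLinearPMap.closure

variable {H}

/-- The graph of the canonical extension of `A` to `H_ρ(ℝ, H)`: the pairs `(u, v)` such that
`u(t) ∈ D(A)` and `v(t) = A u(t)` for almost every `t`. -/
def timeLiftGraph (A : H →ₗ.[ℂ] H) : Submodule ℂ (HRho ρ H × HRho ρ H) where
  carrier := {p | ∀ᵐ t ∂timeMeasure ρ, (p.1 t, p.2 t) ∈ A.graph}
  zero_mem' := by
    filter_upwards [Lp.coeFn_zero H 2 (timeMeasure ρ)] with t h
    simp only [Prod.fst_zero, Prod.snd_zero, h]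
    exact A.graph.zero_mem
  add_mem' := by
    intro p q hp hq
    filter_upwards [hp, hq, Lp.coeFn_add p.1 q.1, Lp.coeFn_add p.2 q.2] with t h1 h2 h3 h4
    simp only [Prod.fst_add, Prod.snd_add, h3, h4]
    exact A.graph.add_mem h1 h2
  smul_mem' := by
    intro a p hp
    filter_upwards [hp, Lp.coeFn_smul a p.1, Lp.coeFn_smul a p.2] with t h1 h2 h3
    simp only [Prod.smul_fst, Prod.smul_snd, h2, h3]
    exact A.graph.smul_mem a h1

/-- The canonical extension of the operator `A` in `H` to an operator in `H_ρ(ℝ, H)`. -/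
def timeLift (A : H →ₗ.[ℂ] H) : HRho ρ H →ₗ.[ℂ] HRho ρ H :=
  (timeLiftGraph ρ A).toLinearPMap

/-- The evolutionary operator `∂₀ M + N + A` in `H_ρ(ℝ, H)`, on its natural domain
`{u | M u ∈ D(∂₀), u ∈ D(A)}`; the bounded operators `M` and `N` act pointwise in time. -/
def evolutionOp (M N : H →L[ℂ] H) (A : H →ₗ.[ℂ] H) : HRho ρ H →ₗ.[ℂ] HRho ρ H :=
  compBounded (timeDeriv ρ H) (M.compLpL 2 (timeMeasure ρ)) +
    (N.compLpL 2 (timeMeasure ρ) : HRho ρ H →ₗ[ℂ] HRho ρ H).toPMap ⊤ + timeLift ρ A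

/-- For every `s ∈ [0,1)` the operator `∂₀ M_s + N_s + A` is closable in `H_ρ(ℝ, H)`, and its
closure has an everywhere defined inverse (the solution operator) of norm at most `1 / c`; and the
solution operators converge strongly, as `s → 0+`, to the one with `s = 0`. -/
def SolutionOperatorsConverge (M N : ℝ → H →L[ℂ] H) (A : H →ₗ.[ℂ] H) (c : ℝ) : Prop :=
  ∃ S : ℝ → HRho ρ H →L[ℂ] HRho ρ H,
    (∀ s ∈ Set.Ico (0 : ℝ) 1,
      (evolutionOp ρ (M s) (N s) A).IsClosable ∧
      IsBoundedInverse (evolutionOp ρ (M s) (N s) A).closure (S s) ∧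
      ‖S s‖ ≤ 1 / c) ∧
    ∀ F : HRho ρ H, Tendsto (fun s => S s F) (𝓝[>] 0) (𝓝 (S 0 F))

end Time

/-! ### The Maxwell operator -/

/-- `ℝ³`. -/
abbrev R3 : Type := EuclideanSpace ℝ (Fin 3)

/-- `ℂ³`. -/
abbrev C3 : Type := EuclideanSpace ℂ (Fin 3)

/-- The partial derivative `∂ⱼ φᵢ`. -/
def pderiv (j i : Fin 3) (φ : R3 → C3) (x : R3) : ℂ :=
  (fderiv ℝ φ x (EuclideanSpace.single j 1)) i

/-- The classical curl of a vector field. -/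
def classicalCurl (φ : R3 → C3) (x : R3) : C3 :=
  !₂[pderiv 1 2 φ x - pderiv 2 1 φ x,
     pderiv 2 0 φ x - pderiv 0 2 φ x,
     pderiv 0 1 φ x - pderiv 1 0 φ x]

lemma classicalCurl_add {φ ψ : R3 → C3} (hφ : Differentiable ℝ φ) (hψ : Differentiable ℝ ψ) :
    classicalCurl (φ + ψ) = classicalCurl φ + classicalCurl ψ := by
  ext x i
  have h : fderiv ℝ (φ + ψ) x = fderiv ℝ φ x + fderiv ℝ ψ x := fderiv_add (hφ x) (hψ x)
  fin_cases i <;> simp [classicalCurl, pderiv, h] <;> ring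

lemma classicalCurl_smul {φ : R3 → C3} (a : ℂ) (hφ : Differentiable ℝ φ) :
    classicalCurl (a • φ) = a • classicalCurl φ := by
  ext x i
  have h : fderiv ℝ (a • φ) x = a • fderiv ℝ φ x := fderiv_const_smul (hφ x) a
  fin_cases i <;> simp [classicalCurl, pderiv, h] <;> ring

/-- `L²(Ω, ℂ³)`. -/
abbrev L2C3 (Ω : Set R3) : Type := Lp C3 2 (volume.restrict Ω)

/-- `L²(Ω, ℂ⁶)`, as the Hilbert space `L²(Ω, ℂ³) × L²(Ω, ℂ³)` of pairs `(E, H)`. -/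
abbrev L2C6 (Ω : Set R3) : Type := WithLp 2 (L2C3 Ω × L2C3 Ω)

/-- The graph of the classical curl on `C¹` vector fields with compact support in `Ω`, as a
subspace of `L²(Ω, ℂ³) × L²(Ω, ℂ³)`. -/
def curlGraph (Ω : Set R3) : Submodule ℂ (L2C3 Ω × L2C3 Ω) where
  carrier := {p | ∃ φ : R3 → C3, ContDiff ℝ 1 φ ∧ HasCompactSupport φ ∧ tsupport φ ⊆ Ω ∧
    p.1 =ᵐ[volume.restrict Ω] φ ∧ p.2 =ᵐ[volume.restrict Ω] classicalCurl φ}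
  zero_mem' := ⟨0, contDiff_zero_fun, HasCompactSupport.zero, by simp [tsupport],
    Lp.coeFn_zero _ _ _, by
      have h : classicalCurl 0 = 0 := by
        simpa using classicalCurl_smul (φ := 0) 0 (differentiable_const 0)
      rw [h]; exact Lp.coeFn_zero _ _ _⟩
  add_mem' := by
    rintro p q ⟨φ, hφ, hφc, hφs, h1, h2⟩ ⟨ψ, hψ, hψc, hψs, h3, h4⟩
    refine ⟨φ + ψ, hφ.add hψ, hφc.add hψc,
      (tsupport_add φ ψ).trans (Set.union_subset hφs hψs),
      (Lp.coeFn_add _ _).trans (h1.add h3), ?_⟩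
    rw [classicalCurl_add (hφ.differentiable one_ne_zero) (hψ.differentiable one_ne_zero)]
    exact (Lp.coeFn_add _ _).trans (h2.add h4)
  smul_mem' := by
    rintro a p ⟨φ, hφ, hφc, hφs, h1, h2⟩
    refine ⟨a • φ, contDiff_const.smul hφ, hφc.smul_left (f := fun _ => a),
      (tsupport_smul_subset_right (fun _ => a) φ).trans hφs,
      (Lp.coeFn_smul _ _).trans (h1.const_smul a), ?_⟩
    rw [classicalCurl_smul a (hφ.differentiable one_ne_zero)]
    exact (Lp.coeFn_smul _ _).trans (h2.const_smul a)

/-- `curl` with the electric boundary condition: the closure in `L²(Ω, ℂ³)` of the classical curl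
on `C¹` vector fields with compact support in `Ω`. -/
def curl0 (Ω : Set R3) : L2C3 Ω →ₗ.[ℂ] L2C3 Ω :=
  (curlGraph Ω).toLinearPMap.closure

/-- The Maxwell operator `A (E, H) = (-curl H, curl0 E)`, where `curl = curl0*`. -/
def maxwellOp (Ω : Set R3) : L2C6 Ω →ₗ.[ℂ] L2C6 Ω :=
  skewBlock (curl0 Ω)

end EddyCurrent

end

open EddyCurrent

noncomputable section

namespace EddyCurrent

/-! ### Evolutionary equations in an abstract Hilbert space -/

section Abstract

variable {K : Type*} [NormedAddCommGroup K] [InnerProductSpace ℂ K]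

/-! Write `D` for the time derivative, `P = D⁻¹` and `J = (1 + A)⁻¹`, both bounded. Integration by
parts against the weight gives `D* = 2ρ - D`, and `A* = -A`; in terms of the bounded inverses these
read `P + P* = 2ρ P*P = 2ρ PP*` and `J + J* = 2J*J = 2JJ*` (`IsNormalInverse`). The coefficients and
`J` act pointwise in time, hence commute with `P`.

Accretivity: since `Re ⟨u, D M u⟩ = ρ ⟨u, M u⟩` and `Re ⟨u, A u⟩ = 0`, positivity of `ρM + Re N`
gives `c ‖u‖² ≤ Re ⟨u, (D M + N + A) u⟩` (`evolution_accretive`). The first identity is clear for `u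
∈ D(D)`; in general only `M u ∈ D(D)`, and `u` is regularized by resolvents of `D`. With a dense
domain, accretivity forces closability, and it bounds the inverse of the closure by `1 / c`.

Dense range: the vectors `P J z` lie in the domain for every choice of `M` and `N`, with image
`coreValue P J M N z`. If `g` is orthogonal to all these images, then `w = P* g` solves a
homogeneous adjoint equation, for which the same positivity yields `w = 0` and so `g = 0`
(`denseRange_coreValue`). Hence the closure has an everywhere defined inverse
(`evolution_solvable`).

Convergence: the core `P J K` is independent of `s`, and the images of a fixed `z` converge as `s →
0+`. So `S s` converges on the dense set of images for `s = 0`, and the uniform bound `1 / c`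
extends this to all right-hand sides (`evolution_tendsto`).

It remains to verify the hypotheses: the properties of `D` in the weighted space
(`exists_timeDeriv_inverse`), those of `J` (`IsSkewSelfAdjoint.exists_resolvent`), the passage from
`H` to functions of time (`tendsto_compLpL` and its neighbours), and skew-selfadjointness of the
Maxwell operator, which needs only a closed, densely defined `curl0` with a densely defined adjoint.
-/

lemma norm_sq_eq_re_inner' (x : K) : ‖x‖ ^ 2 = (inner ℂ x x).re := by
  simpa using (inner_self_eq_norm_sq (𝕜 := ℂ) x).symm

lemma re_inner_comm (x y : K) : (inner ℂ x y).re = (inner ℂ y x).re := by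
  simpa using inner_re_symm (𝕜 := ℂ) x y

/-- The accretivity estimate passes to the closure of a graph. -/
lemma accretive_closure {G : Submodule ℂ (K × K)} {c : ℝ}
    (hacc : ∀ p ∈ G, c * ‖p.1‖ ^ 2 ≤ (inner ℂ p.1 p.2).re) :
    ∀ p ∈ G.topologicalClosure, c * ‖p.1‖ ^ 2 ≤ (inner ℂ p.1 p.2).re := by
  have hcl : IsClosed {p : K × K | c * ‖p.1‖ ^ 2 ≤ (inner ℂ p.1 p.2).re} :=
    isClosed_le (by fun_prop) (by fun_prop)
  intro p hp
  exact closure_minimal (fun q hq => hacc q hq) hcl hp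

lemma norm_fst_le_of_accretive {c : ℝ} (hc : 0 < c) {x y : K}
    (h : c * ‖x‖ ^ 2 ≤ (inner ℂ x y).re) : ‖x‖ ≤ 1 / c * ‖y‖ := by
  rcases eq_or_ne x 0 with rfl | hx
  · simp; positivity
  have hx' : 0 < ‖x‖ := norm_pos_iff.2 hx
  have h1 : (inner ℂ x y).re ≤ ‖x‖ * ‖y‖ := re_inner_le_norm (𝕜 := ℂ) x y
  have h2 : c * ‖x‖ ≤ ‖y‖ := by
    by_contra! h3
    nlinarith
  rw [div_mul_eq_mul_div, one_mul, le_div_iff₀ hc]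
  linarith

/-- A closed strictly accretive graph with dense range has an everywhere defined bounded
inverse. -/
theorem exists_boundedInverse [CompleteSpace K] {G : Submodule ℂ (K × K)}
    (hG : IsClosed (G : Set (K × K))) {c : ℝ} (hc : 0 < c)
    (hacc : ∀ p ∈ G, c * ‖p.1‖ ^ 2 ≤ (inner ℂ p.1 p.2).re)
    (hdense : Dense (Prod.snd '' (G : Set (K × K)))) :
    ∃ S : K →L[ℂ] K, ‖S‖ ≤ 1 / c ∧ ∀ u f : K, (u, f) ∈ G ↔ S f = u := by
  have hbd : ∀ p ∈ G, ‖p.1‖ ≤ 1 / c * ‖p.2‖ := fun p hp =>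
    norm_fst_le_of_accretive hc (hacc p hp)
  have : CompleteSpace G := hG.completeSpace_coe
  -- The projection of the graph to its second component is bounded below by accretivity, so its
  -- range is closed; being dense, it is everything.
  let L : G →L[ℂ] K := (ContinuousLinearMap.snd ℂ K K).comp G.subtypeL
  have hanti : AntilipschitzWith (max (1 / c) 1).toNNReal L := by
    refine ContinuousLinearMap.antilipschitz_of_bound L fun x => ?_
    rw [Real.coe_toNNReal _ (by positivity)]
    have h1 := hbd x.1 x.2
    change max ‖x.1.1‖ ‖x.1.2‖ ≤ max (1 / c) 1 * ‖x.1.2‖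
    have h2 : 1 / c * ‖x.1.2‖ ≤ max (1 / c) 1 * ‖x.1.2‖ := by gcongr; exact le_max_left _ _
    have h3 : 1 * ‖x.1.2‖ ≤ max (1 / c) 1 * ‖x.1.2‖ := by gcongr; exact le_max_right _ _
    exact max_le (h1.trans h2) (by linarith)
  have hrange : IsClosed (Set.range L) := hanti.isClosed_range L.uniformContinuous
  have hrange' : Set.range L = Prod.snd '' (G : Set (K × K)) := by
    ext y
    constructor
    · rintro ⟨x, rfl⟩; exact ⟨x.1, x.2, rfl⟩
    · rintro ⟨x, hx, rfl⟩; exact ⟨⟨x, hx⟩, rfl⟩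
  have hsurj : Function.Surjective L := by
    rw [← Set.range_eq_univ, ← hrange.closure_eq, hrange']
    exact hdense.closure_eq
  let e : G ≃ₗ[ℂ] K := LinearEquiv.ofBijective (L : G →ₗ[ℂ] K) ⟨hanti.injective, hsurj⟩
  let S₀ : K →ₗ[ℂ] K := (LinearMap.fst ℂ K K).comp (G.subtype.comp e.symm.toLinearMap)
  have he : ∀ f, (e.symm f).1.2 = f := fun f => e.apply_symm_apply f
  have hS₀ : ∀ f, ‖S₀ f‖ ≤ 1 / c * ‖f‖ := fun f => by
    have h1 := hbd (e.symm f).1 (e.symm f).2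
    rw [he] at h1
    exact h1
  refine ⟨S₀.mkContinuous (1 / c) hS₀, LinearMap.mkContinuous_norm_le _ (by positivity) _,
    fun u f => ?_⟩
  rw [LinearMap.mkContinuous_apply]
  constructor
  · intro h
    have h1 : e ⟨(u, f), h⟩ = f := rfl
    change (e.symm f).1.1 = u
    rw [e.symm_apply_eq.2 h1.symm]
  · intro h
    have h1 : ((e.symm f).1.1, (e.symm f).1.2) ∈ G := (e.symm f).2
    rw [he] at h1
    rwa [← h]

/-- A graph that satisfies an accretivity estimate and has a dense domain is single-valued. -/
lemma snd_eq_zero_of_accretive {G : Submodule ℂ (K × K)} {c : ℝ}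
    (hacc : ∀ p ∈ G, c * ‖p.1‖ ^ 2 ≤ (inner ℂ p.1 p.2).re)
    (hdense : Dense (Prod.fst '' (G : Set (K × K)))) :
    ∀ p ∈ G, p.1 = 0 → p.2 = 0 := by
  rintro ⟨x, y⟩ hp hx
  obtain rfl : x = 0 := hx
  have hzero : ∀ q ∈ G, (inner ℂ q.1 y).re = 0 := by
    intro q hq
    -- Adding a multiple of `(0, y)` to `q` leaves the first component alone, so accretivity becomes
    -- an inequality affine in `s`, valid for all real `s`; the slope must vanish.
    have key : ∀ s : ℝ, c * ‖q.1‖ ^ 2 - (inner ℂ q.1 q.2).re ≤ s * (inner ℂ q.1 y).re := by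
      intro s
      have h := hacc _ (G.add_mem hq (G.smul_mem (s : ℂ) hp))
      simp only [Prod.fst_add, Prod.smul_fst, smul_zero, add_zero, Prod.snd_add, Prod.smul_snd,
        inner_add_right, inner_smul_right, Complex.add_re, Complex.re_ofReal_mul] at h
      linarith
    by_contra hne
    have h := key ((c * ‖q.1‖ ^ 2 - (inner ℂ q.1 q.2).re - 1) / (inner ℂ q.1 y).re)
    rw [div_mul_cancel₀ _ hne] at h
    linarith
  have hcl : IsClosed {z : K | (inner ℂ z y).re = 0} :=
    isClosed_eq (by fun_prop) continuous_const
  have hy : y ∈ {z : K | (inner ℂ z y).re = 0} :=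
    hcl.closure_subset_iff.2 (by rintro _ ⟨q, hq, rfl⟩; exact hzero q hq) (hdense y)
  have h : ‖y‖ ^ 2 = 0 := by rw [norm_sq_eq_re_inner']; exact hy
  simpa using h

lemma isClosable_of_snd_eq_zero {X Y : Type*} [NormedAddCommGroup X] [NormedSpace ℂ X]
    [NormedAddCommGroup Y] [NormedSpace ℂ Y] {T : X →ₗ.[ℂ] Y}
    (h : ∀ p ∈ T.graph.topologicalClosure, p.1 = 0 → p.2 = 0) : T.IsClosable :=
  ⟨T.graph.topologicalClosure.toLinearPMap, (Submodule.toLinearPMap_graph_eq _ h).symm⟩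

/-- If the closure of a subspace of `X × Y` is single-valued, then it is the graph of the closure
of the operator which the subspace defines. -/
lemma graph_closure_toLinearPMap {X Y : Type*} [NormedAddCommGroup X] [NormedSpace ℂ X]
    [NormedAddCommGroup Y] [NormedSpace ℂ Y] {G : Submodule ℂ (X × Y)}
    (h : ∀ p ∈ G.topologicalClosure, p.1 = 0 → p.2 = 0) :
    G.toLinearPMap.closure.graph = G.topologicalClosure := by
  have h1 : G.toLinearPMap.graph = G :=
    Submodule.toLinearPMap_graph_eq _ fun p hp => h p (G.le_topologicalClosure hp)
  have h2 : G.toLinearPMap.IsClosable := isClosable_of_snd_eq_zero (by rwa [h1])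
  rw [← h2.graph_closure_eq_closure_graph, h1]

lemma dense_image_mono {X Y : Type*} [TopologicalSpace Y] (f : X → Y) {s t : Set X} (h : s ⊆ t)
    (hs : Dense (f '' s)) : Dense (f '' t) := hs.mono (Set.image_mono h)

/-- The values of `D M + N + A` on the core `P J K`, where `D = P⁻¹` and `J = (1 + A)⁻¹`. -/
def coreValue (P J M N : K →L[ℂ] K) : K →L[ℂ] K :=
  M ∘L J + P ∘L N ∘L J + P ∘L (ContinuousLinearMap.id ℂ K - J)

lemma coreValue_apply {P J M N : K →L[ℂ] K} (z : K) :
    coreValue P J M N z = M (J z) + P (N (J z)) + P (z - J z) := rfl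

variable [CompleteSpace K]

/-- `P` is injective and `P + P* = κ P* P = κ P P*`, i.e. `P = D⁻¹` for an operator `D` such that
`D - κ / 2` is skew-selfadjoint. -/
structure IsNormalInverse (κ : ℝ) (P : K →L[ℂ] K) : Prop where
  injective : ∀ x, P x = 0 → x = 0
  adjoint_mul : ∀ x, P x + (P.adjoint) x = (κ : ℂ) • (P.adjoint) (P x)
  mul_adjoint : ∀ x, P x + (P.adjoint) x = (κ : ℂ) • P ((P.adjoint) x)

namespace IsNormalInverse

variable {κ : ℝ} {P : K →L[ℂ] K}

lemma adjoint_injective (hP : IsNormalInverse κ P) (x : K) (hx : P.adjoint x = 0) : x = 0 := by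
  have h := hP.mul_adjoint x
  rw [hx, map_zero, smul_zero, add_zero] at h
  exact hP.injective x h

/-- For `u = P x` and `D = P⁻¹` this is `Re ⟨u, D u⟩ = (κ / 2) ‖u‖²`, obtained by pairing
`adjoint_mul` with `x`. -/
lemma re_inner_apply (hP : IsNormalInverse κ P) (x : K) : 2 * (inner ℂ (P x) x).re = κ * ‖P x‖ ^ 2 := by
  have h := congrArg (fun z => (inner ℂ z x).re) (hP.adjoint_mul x)
  simp only [inner_add_left, inner_smul_left, ContinuousLinearMap.adjoint_inner_left,
    Complex.add_re, Complex.conj_ofReal, Complex.re_ofReal_mul] at h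
  rw [← norm_sq_eq_re_inner', re_inner_comm x] at h
  linarith

lemma re_inner_adjoint_apply (hP : IsNormalInverse κ P) (x : K) :
    2 * (inner ℂ (P.adjoint x) x).re = κ * ‖P.adjoint x‖ ^ 2 := by
  have h := congrArg (fun z => (inner ℂ z x).re) (hP.mul_adjoint x)
  simp only [inner_add_left, inner_smul_left, ContinuousLinearMap.adjoint_inner_left,
    Complex.add_re, Complex.conj_ofReal, Complex.re_ofReal_mul] at h
  have e1 : (inner ℂ (P x) x).re = (inner ℂ (P.adjoint x) x).re := by
    rw [re_inner_comm, ContinuousLinearMap.adjoint_inner_left]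
  have e2 : (inner ℂ (P (P.adjoint x)) x).re = ‖P.adjoint x‖ ^ 2 := by
    rw [← ContinuousLinearMap.adjoint_inner_right, norm_sq_eq_re_inner']
  rw [re_inner_comm x, e1, e2] at h
  linarith

end IsNormalInverse

/-- An operator has dense range if only zero is orthogonal to its range. -/
lemma dense_range_of_inner_eq_zero (L : K →L[ℂ] K) (h : ∀ g, (∀ z, inner ℂ g (L z) = 0) → g = 0) :
    DenseRange L := by
  have h1 : (L.range)ᗮ = ⊥ := by
    rw [Submodule.eq_bot_iff]
    intro g hg
    refine h g fun z => ?_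
    rw [Submodule.mem_orthogonal'] at hg
    exact hg _ ⟨z, rfl⟩
  have h2 := Submodule.topologicalClosure_eq_top_iff.2 h1
  have h3 := Submodule.dense_iff_topologicalClosure_eq_top.2 h2
  exact h3

variable {ρ c : ℝ} {P J M N : K →L[ℂ] K}

/-- Pair `mul_adjoint` with `M x` and move `M` across `P`. For `w = P* x`, so that `x = D* w`, the
result reads `Re ⟨w, M D* w⟩ = ρ ⟨w, M w⟩`; it serves the adjoint equation in the dense range
argument. -/
lemma IsNormalInverse.re_inner_mul (hP : IsNormalInverse (2 * ρ) P) (hM : IsSelfAdjoint M)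
    (hMP : ∀ x, M (P x) = P (M x)) (x : K) :
    (inner ℂ (P.adjoint x) (M x)).re = ρ * (inner ℂ (P.adjoint x) (M (P.adjoint x))).re := by
  have hM' : ∀ x y, inner ℂ (M x) y = inner ℂ x (M y) := fun x y => by
    rw [← ContinuousLinearMap.adjoint_inner_right, hM.adjoint_eq]
  have h := congrArg (fun z => (inner ℂ (M x) z).re) (hP.mul_adjoint x)
  simp only [inner_add_right, inner_smul_right, Complex.add_re, Complex.re_ofReal_mul] at h
  have e1 : inner ℂ (M x) (P x) = inner ℂ (P.adjoint x) (M x) := by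
    rw [hM', hMP, ContinuousLinearMap.adjoint_inner_left]
  have e2 : inner ℂ (M x) (P (P.adjoint x)) = inner ℂ (P.adjoint x) (M (P.adjoint x)) := by
    rw [hM', hMP, ContinuousLinearMap.adjoint_inner_left]
  rw [e1, e2, re_inner_comm (M x)] at h
  linarith

/-- The counterpart for `u = P x`: `Re ⟨u, M D u⟩ = ρ ⟨u, M u⟩`, used for accretivity. -/
lemma IsNormalInverse.re_inner_mul' (hP : IsNormalInverse (2 * ρ) P) (hM : IsSelfAdjoint M)
    (hMP : ∀ x, M (P x) = P (M x)) (x : K) :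
    (inner ℂ (P x) (M x)).re = ρ * (inner ℂ (P x) (M (P x))).re := by
  have hM' : ∀ x y, inner ℂ (M x) y = inner ℂ x (M y) := fun x y => by
    rw [← ContinuousLinearMap.adjoint_inner_right, hM.adjoint_eq]
  have h := congrArg (fun z => (inner ℂ (M x) z).re) (hP.adjoint_mul x)
  simp only [inner_add_right, inner_smul_right, Complex.add_re, Complex.re_ofReal_mul] at h
  have e1 : inner ℂ (M x) (P.adjoint x) = inner ℂ (P x) (M x) := by
    rw [ContinuousLinearMap.adjoint_inner_right, ← hMP, hM']
  have e2 : inner ℂ (M x) (P.adjoint (P x)) = inner ℂ (P x) (M (P x)) := by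
    rw [ContinuousLinearMap.adjoint_inner_right, ← hMP, hM']
  rw [e1, e2, re_inner_comm (M x)] at h
  linarith

/-- The values of the evolutionary operator on its core are dense. -/
theorem denseRange_coreValue (hc : 0 < c) (hP : IsNormalInverse (2 * ρ) P)
    (hJ : IsNormalInverse 2 J) (hM : IsSelfAdjoint M) (hMP : ∀ x, M (P x) = P (M x))
    (hge : ReGE ((ρ : ℂ) • M + N) c) : DenseRange (coreValue P J M N) := by
  refine dense_range_of_inner_eq_zero _ fun g hg => ?_
  set w := P.adjoint g with hw
  set h := M g + N.adjoint w with hh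
  -- As `J* = (1 - A)⁻¹`, this says `A w = h`; taking the inner product with `w` then removes `A`.
  have h1 : w = J.adjoint (w - h) := by
    refine ext_inner_right ℂ fun z => ?_
    have hz := hg z
    rw [coreValue_apply, inner_add_right, inner_add_right, ← ContinuousLinearMap.adjoint_inner_left,
      ← ContinuousLinearMap.adjoint_inner_left P, ← ContinuousLinearMap.adjoint_inner_left P,
      ← ContinuousLinearMap.adjoint_inner_left N, hM.adjoint_eq, ← hw, inner_sub_right] at hz
    rw [hw, ContinuousLinearMap.adjoint_inner_left, ContinuousLinearMap.adjoint_inner_left J,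
      inner_sub_left, hh, inner_add_left, ← hw]
    rw [← ContinuousLinearMap.adjoint_inner_left P, ← hw]
    linear_combination hz
  have h2 : (inner ℂ w h).re = 0 := by
    have h3 := hJ.re_inner_adjoint_apply (w - h)
    rw [← h1, inner_sub_right, Complex.sub_re, ← norm_sq_eq_re_inner'] at h3
    linarith
  have h4 : c * ‖w‖ ^ 2 ≤ 0 := by
    refine (hge w).trans_eq ?_
    rw [hh, inner_add_right, Complex.add_re, hw, hP.re_inner_mul hM hMP, ← hw,
      ContinuousLinearMap.adjoint_inner_right, re_inner_comm (N w)] at h2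
    rw [add_apply, smul_apply, inner_add_right,
      inner_smul_right, Complex.add_re, Complex.re_ofReal_mul]
    exact h2
  have h5 : w = 0 := by
    by_contra hne
    have := norm_pos_iff.2 hne
    have : 0 < c * ‖w‖ ^ 2 := by positivity
    linarith
  exact hP.adjoint_injective g h5

/-- The evolutionary operator is strictly accretive. -/
theorem evolution_accretive (hP : IsNormalInverse (2 * ρ) P) (hJ : IsNormalInverse 2 J)
    (hM : IsSelfAdjoint M) (hMP : ∀ x, M (P x) = P (M x)) (hge : ReGE ((ρ : ℂ) • M + N) c)
    {R W : ℕ → K →L[ℂ] K} (hR : ∀ x, Tendsto (fun n => R n x) atTop (𝓝 x))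
    (hRW : ∀ n x, R n x = P (W n x)) (hRP : ∀ n x, R n (P x) = P (R n x))
    (hRM : ∀ n x, R n (M x) = M (R n x))
    {u d a : K} (hd : P d = M u) (ha : J (u + a) = u) :
    c * ‖u‖ ^ 2 ≤ (inner ℂ u (d + N u + a)).re := by
  -- Here `u` need not lie in the range of `P`, only `M u` does. The regularized `R n u = P (W n u)`
  -- does lie there, and `D M R n u = R n d` because `R n` commutes with `M` and `P`.
  have h1 : ∀ n, (inner ℂ (R n u) (R n d)).re = ρ * (inner ℂ (R n u) (M (R n u))).re := by
    intro n
    have h2 : M (W n u) = R n d := by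
      have : P (M (W n u) - R n d) = 0 := by
        rw [map_sub, ← hMP, ← hRW, ← hRM, ← hd, hRP, sub_self]
      exact sub_eq_zero.1 (hP.injective _ this)
    rw [← h2, hRW, hP.re_inner_mul' hM hMP]
  have h3 : (inner ℂ u d).re = ρ * (inner ℂ u (M u)).re := by
    have t1 : Tendsto (fun n => (inner ℂ (R n u) (R n d)).re) atTop (𝓝 (inner ℂ u d).re) :=
      (Complex.continuous_re.tendsto _).comp ((hR u).inner (hR d))
    have t2 : Tendsto (fun n => ρ * (inner ℂ (R n u) (M (R n u))).re) atTop
        (𝓝 (ρ * (inner ℂ u (M u)).re)) :=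
      ((Complex.continuous_re.tendsto _).comp
        ((hR u).inner ((M.continuous.tendsto _).comp (hR u)))).const_mul _
    exact tendsto_nhds_unique t1 (t2.congr fun n => (h1 n).symm)
  have h4 : (inner ℂ u a).re = 0 := by
    have h5 := hJ.re_inner_apply (u + a)
    rw [ha, inner_add_right, Complex.add_re, ← norm_sq_eq_re_inner'] at h5
    linarith
  have h6 := hge u
  rw [add_apply, smul_apply, inner_add_right,
    inner_smul_right, Complex.add_re, Complex.re_ofReal_mul] at h6
  rw [inner_add_right, inner_add_right, Complex.add_re, Complex.add_re]
  linarith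

/-- The evolutionary operator is closable, and its closure is boundedly invertible. -/
theorem evolution_solvable (hc : 0 < c) (hP : IsNormalInverse (2 * ρ) P)
    (hJ : IsNormalInverse 2 J) (hM : IsSelfAdjoint M) (hMP : ∀ x, M (P x) = P (M x))
    (hNP : ∀ x, N (P x) = P (N x)) (hJP : ∀ x, J (P x) = P (J x))
    (hge : ReGE ((ρ : ℂ) • M + N) c)
    {R W : ℕ → K →L[ℂ] K} (hR : ∀ x, Tendsto (fun n => R n x) atTop (𝓝 x))
    (hRW : ∀ n x, R n x = P (W n x)) (hRP : ∀ n x, R n (P x) = P (R n x))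
    (hRM : ∀ n x, R n (M x) = M (R n x)) {T : K →ₗ.[ℂ] K}
    (hT : ∀ u f, (u, f) ∈ T.graph ↔ ∃ d a, P d = M u ∧ J (u + a) = u ∧ f = d + N u + a) :
    T.IsClosable ∧ ∃ S : K →L[ℂ] K, IsBoundedInverse T.closure S ∧ ‖S‖ ≤ 1 / c ∧
      ∀ z, S (coreValue P J M N z) = P (J z) := by
  have hcore : ∀ z, (P (J z), coreValue P J M N z) ∈ T.graph := fun z =>
    (hT _ _).2 ⟨M (J z), P (z - J z), (hMP _).symm, by
      rw [← map_add, hJP, add_sub_cancel], by rw [coreValue_apply, hNP]⟩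
  have hacc : ∀ p ∈ T.graph.topologicalClosure, c * ‖p.1‖ ^ 2 ≤ (inner ℂ p.1 p.2).re := by
    refine accretive_closure ?_
    rintro ⟨u, f⟩ hp
    obtain ⟨d, a, hd, ha, rfl⟩ := (hT u f).1 hp
    exact evolution_accretive hP hJ hM hMP hge hR hRW hRP hRM hd ha
  -- The core `P J K` is already dense, because `P*` and `J*` are injective.
  have hdom : Dense (Prod.fst '' (T.graph.topologicalClosure : Set (K × K))) := by
    have h : DenseRange (P ∘L J) := by
      refine dense_range_of_inner_eq_zero _ fun g hg => ?_
      refine hP.adjoint_injective g (hJ.adjoint_injective _ (ext_inner_right ℂ fun z => ?_))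
      rw [ContinuousLinearMap.adjoint_inner_left, ContinuousLinearMap.adjoint_inner_left,
        inner_zero_left]
      exact hg z
    refine Dense.mono ?_ h
    rintro _ ⟨z, rfl⟩
    exact ⟨_, T.graph.le_topologicalClosure (hcore z), rfl⟩
  have hran : Dense (Prod.snd '' (T.graph.topologicalClosure : Set (K × K))) := by
    refine Dense.mono ?_ (denseRange_coreValue hc hP hJ hM hMP hge)
    rintro _ ⟨z, rfl⟩
    exact ⟨_, T.graph.le_topologicalClosure (hcore z), rfl⟩
  have hclos : T.IsClosable := isClosable_of_snd_eq_zero (snd_eq_zero_of_accretive hacc hdom)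
  obtain ⟨S, hS, hSG⟩ :=
    exists_boundedInverse T.graph.isClosed_topologicalClosure hc hacc hran
  refine ⟨hclos, S, fun u f => ?_, hS, fun z => ?_⟩
  · rw [← hclos.graph_closure_eq_closure_graph, hSG]
  · exact (hSG _ _).1 (T.graph.le_topologicalClosure (hcore z))

/-- Strong convergence of the solution operators. -/
theorem evolution_tendsto {ι : Type*} {l : Filter ι} {S M N : ι → K →L[ℂ] K} (hc : 0 < c)
    {S₀ M₀ N₀ : K →L[ℂ] K} (hP : IsNormalInverse (2 * ρ) P)
    (hJ : IsNormalInverse 2 J) (hM : IsSelfAdjoint M₀) (hMP : ∀ x, M₀ (P x) = P (M₀ x))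
    (hge : ReGE ((ρ : ℂ) • M₀ + N₀) c)
    (hS : ∀ᶠ s in l, ‖S s‖ ≤ 1 / c ∧ ∀ z, S s (coreValue P J (M s) (N s) z) = P (J z))
    (hS₀ : ‖S₀‖ ≤ 1 / c) (hS₀' : ∀ z, S₀ (coreValue P J M₀ N₀ z) = P (J z))
    (hMt : ∀ x, Tendsto (fun s => M s x) l (𝓝 (M₀ x)))
    (hNt : ∀ x, Tendsto (fun s => N s x) l (𝓝 (N₀ x))) (F : K) :
    Tendsto (fun s => S s F) l (𝓝 (S₀ F)) := by
  have hcore : ∀ z, Tendsto (fun s => S s (coreValue P J M₀ N₀ z)) l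
      (𝓝 (S₀ (coreValue P J M₀ N₀ z))) := by
    intro z
    rw [tendsto_iff_norm_sub_tendsto_zero]
    have h1 : Tendsto (fun s => coreValue P J (M s) (N s) z) l (𝓝 (coreValue P J M₀ N₀ z)) := by
      simp only [coreValue_apply]
      exact ((hMt _).add ((P.continuous.tendsto _).comp (hNt _))).add_const _
    have h2 : Tendsto (fun s => 1 / c * ‖coreValue P J M₀ N₀ z - coreValue P J (M s) (N s) z‖) l
        (𝓝 0) := by
      simpa using (((tendsto_const_nhds (x := coreValue P J M₀ N₀ z)).sub h1).norm).const_mul (1 / c)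
    refine squeeze_zero' (Eventually.of_forall fun _ => norm_nonneg _) ?_ h2
    filter_upwards [hS] with s hs
    -- `P J z` is the solution for both operators, with different right-hand sides; so the error is
    -- `S s` applied to the difference of the two core values.
    rw [hS₀', ← hs.2 z, ← map_sub]
    exact (S s).le_of_opNorm_le hs.1 _
  rw [Metric.tendsto_nhds]
  intro ε hε
  -- The tolerance `c ε / 3` turns into `ε / 3` after applying an operator of norm at most `1 / c`.
  obtain ⟨z, hz⟩ := (denseRange_coreValue hc hP hJ hM hMP hge).exists_dist_lt F
    (show 0 < c * ε / 3 by positivity)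
  have hz' : 1 / c * ‖F - coreValue P J M₀ N₀ z‖ < ε / 3 := by
    rw [dist_eq_norm] at hz
    rw [div_mul_eq_mul_div, one_mul, div_lt_iff₀ hc]
    linarith
  filter_upwards [hS, Metric.tendsto_nhds.1 (hcore z) (ε / 3) (by positivity)] with s hs hs'
  have e1 := (S s).le_of_opNorm_le hs.1 (F - coreValue P J M₀ N₀ z)
  have e2 := S₀.le_of_opNorm_le hS₀ (F - coreValue P J M₀ N₀ z)
  rw [map_sub, ← dist_eq_norm] at e1 e2
  rw [dist_comm] at e2
  have := dist_triangle4 (S s F) (S s (coreValue P J M₀ N₀ z)) (S₀ (coreValue P J M₀ N₀ z)) (S₀ F)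
  linarith

end Abstract

/-! ### The time derivative in the weighted space and its resolvents -/

section TimeDerivative

variable {ρ : ℝ} {H : Type*} [NormedAddCommGroup H] [InnerProductSpace ℂ H]

instance isLocallyFiniteMeasure_timeMeasure : IsLocallyFiniteMeasure (timeMeasure ρ) :=
  IsLocallyFiniteMeasure.withDensity_ofReal (by fun_prop)

lemma integral_timeMeasure {E : Type*} [NormedAddCommGroup E] [NormedSpace ℝ E] (f : ℝ → E) :
    ∫ t, f t ∂timeMeasure ρ = ∫ t, Real.exp (-2 * ρ * t) • f t := by
  rw [timeMeasure, integral_withDensity_eq_integral_toReal_smul (by fun_prop)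
    (Eventually.of_forall fun _ => ENNReal.ofReal_lt_top)]
  simp_rw [ENNReal.toReal_ofReal (Real.exp_nonneg _)]

lemma inner_HRho {u v : HRho ρ H} {φ ψ : ℝ → H} (hu : u =ᵐ[timeMeasure ρ] φ)
    (hv : v =ᵐ[timeMeasure ρ] ψ) :
    inner ℂ u v = ∫ t, Real.exp (-2 * ρ * t) • (inner ℂ (φ t) (ψ t) : ℂ) := by
  rw [L2.inner_def, ← integral_timeMeasure]
  refine integral_congr_ae ?_
  filter_upwards [hu, hv] with t h1 h2
  rw [h1, h2]

lemma hasCompactSupport_inner {X : Type*} [TopologicalSpace X] {φ ψ : X → H}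
    (hφ : HasCompactSupport φ) : HasCompactSupport fun t => (inner ℂ (φ t) (ψ t) : ℂ) :=
  hφ.mono fun t ht h => ht (by simp [h])

/-- Integration by parts in `H_ρ(ℝ, H)`. -/
lemma timeDerivGraph_inner {p q : HRho ρ H × HRho ρ H} (hp : p ∈ timeDerivGraph ρ H)
    (hq : q ∈ timeDerivGraph ρ H) :
    inner ℂ p.1 q.2 + inner ℂ p.2 q.1 = (2 * ρ : ℂ) * inner ℂ p.1 q.1 := by
  obtain ⟨φ, hφ, hφc, h1, h2⟩ := hp
  obtain ⟨ψ, hψ, hψc, h3, h4⟩ := hq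
  have hφ' : Continuous (deriv φ) := hφ.continuous_deriv le_rfl
  have hψ' : Continuous (deriv ψ) := hψ.continuous_deriv le_rfl
  have hφ₀ := hφ.continuous
  have hψ₀ := hψ.continuous
  have i1 : Integrable fun t => Real.exp (-2 * ρ * t) • (inner ℂ (φ t) (deriv ψ t) : ℂ) :=
    Continuous.integrable_of_hasCompactSupport (by fun_prop)
      ((hasCompactSupport_inner hφc).smul_left (f := fun t => Real.exp (-2 * ρ * t)))
  have i2 : Integrable fun t => Real.exp (-2 * ρ * t) • (inner ℂ (deriv φ t) (ψ t) : ℂ) :=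
    Continuous.integrable_of_hasCompactSupport (by fun_prop)
      ((hasCompactSupport_inner hφc.deriv).smul_left (f := fun t => Real.exp (-2 * ρ * t)))
  have i3 : Integrable fun t => Real.exp (-2 * ρ * t) • (inner ℂ (φ t) (ψ t) : ℂ) :=
    Continuous.integrable_of_hasCompactSupport (by fun_prop)
      ((hasCompactSupport_inner hφc).smul_left (f := fun t => Real.exp (-2 * ρ * t)))
  have hder : ∀ t, HasDerivAt (fun t => Real.exp (-2 * ρ * t) • (inner ℂ (φ t) (ψ t) : ℂ))
      (Real.exp (-2 * ρ * t) • (inner ℂ (φ t) (deriv ψ t) : ℂ) +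
        Real.exp (-2 * ρ * t) • (inner ℂ (deriv φ t) (ψ t) : ℂ) -
        (2 * ρ : ℂ) * Real.exp (-2 * ρ * t) • (inner ℂ (φ t) (ψ t) : ℂ)) t := by
    intro t
    have d1 : HasDerivAt φ (deriv φ t) t := (hφ.differentiable one_ne_zero t).hasDerivAt
    have d2 : HasDerivAt ψ (deriv ψ t) t := (hψ.differentiable one_ne_zero t).hasDerivAt
    have d3 : HasDerivAt (fun t : ℝ => Real.exp (-2 * ρ * t))
        (Real.exp (-2 * ρ * t) * (-2 * ρ)) t := by
      simpa using ((hasDerivAt_id t).const_mul (-2 * ρ)).exp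
    refine (d3.smul (d1.inner ℂ d2)).congr_deriv ?_
    simp only [Complex.real_smul]
    push_cast
    ring
  have h0 := integral_eq_zero_of_hasDerivAt_of_integrable hder
    ((i1.add i2).sub (i3.const_mul _)) i3
  have h5 := integral_sub (i1.add i2) (i3.const_mul (2 * ρ : ℂ))
  simp only [Pi.add_apply] at h5
  -- The integral of the derivative of `exp (-2ρt) ⟨φ, ψ⟩` vanishes; the term `2ρ` comes from
  -- differentiating the weight.
  rw [h5, integral_add i1 i2, integral_const_mul, ← inner_HRho h1 h4, ← inner_HRho h2 h3,
    ← inner_HRho h1 h3] at h0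
  exact sub_eq_zero.1 h0

lemma timeDerivGraph_closure_inner {p q : HRho ρ H × HRho ρ H}
    (hp : p ∈ (timeDerivGraph ρ H).topologicalClosure)
    (hq : q ∈ (timeDerivGraph ρ H).topologicalClosure) :
    inner ℂ p.1 q.2 + inner ℂ p.2 q.1 = (2 * ρ : ℂ) * inner ℂ p.1 q.1 := by
  have h1 : ∀ q ∈ timeDerivGraph ρ H, ∀ p ∈ (timeDerivGraph ρ H).topologicalClosure,
      inner ℂ p.1 q.2 + inner ℂ p.2 q.1 = (2 * ρ : ℂ) * inner ℂ p.1 q.1 := fun q hq p hp =>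
    closure_minimal (t := {p : HRho ρ H × HRho ρ H |
        inner ℂ p.1 q.2 + inner ℂ p.2 q.1 = (2 * ρ : ℂ) * inner ℂ p.1 q.1})
      (fun p hp => timeDerivGraph_inner hp hq) (isClosed_eq (by fun_prop) (by fun_prop)) hp
  exact closure_minimal (t := {q : HRho ρ H × HRho ρ H |
        inner ℂ p.1 q.2 + inner ℂ p.2 q.1 = (2 * ρ : ℂ) * inner ℂ p.1 q.1})
      (fun q hq => h1 q hq p hp) (isClosed_eq (by fun_prop) (by fun_prop)) hq

lemma timeDerivGraph_closure_re_inner {p : HRho ρ H × HRho ρ H}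
    (hp : p ∈ (timeDerivGraph ρ H).topologicalClosure) :
    (inner ℂ p.1 p.2).re = ρ * ‖p.1‖ ^ 2 := by
  have h := congrArg Complex.re (timeDerivGraph_closure_inner hp hp)
  rw [Complex.add_re, re_inner_comm p.2, show (2 * ρ : ℂ) = ((2 * ρ : ℝ) : ℂ) by simp,
    Complex.re_ofReal_mul, ← norm_sq_eq_re_inner'] at h
  linarith

lemma memLp_timeMeasure {E : Type*} [NormedAddCommGroup E] {φ : ℝ → E} (hφ : Continuous φ) (hφc : HasCompactSupport φ) :
    MemLp φ 2 (timeMeasure ρ) := hφ.memLp_of_hasCompactSupport hφc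

lemma toLp_mem_timeDerivGraph {φ : ℝ → H} (hφ : ContDiff ℝ 1 φ) (hφc : HasCompactSupport φ) :
    ((memLp_timeMeasure hφ.continuous hφc).toLp φ,
      (memLp_timeMeasure (hφ.continuous_deriv le_rfl) hφc.deriv).toLp (deriv φ)) ∈
      timeDerivGraph ρ H :=
  ⟨φ, hφ, hφc, (memLp_timeMeasure hφ.continuous hφc).coeFn_toLp,
    (memLp_timeMeasure (hφ.continuous_deriv le_rfl) hφc.deriv).coeFn_toLp⟩

lemma dense_timeDerivGraph_fst : Dense (Prod.fst '' (timeDerivGraph ρ H : Set (HRho ρ H × HRho ρ H))) := by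
  refine Dense.mono ?_ (Lp.dense_hasCompactSupport_contDiff (F := H) (μ := timeMeasure ρ)
    (p := 2) ENNReal.ofNat_ne_top)
  rintro f ⟨φ, hf, hφc, hφ⟩
  have hφ1 : ContDiff ℝ 1 φ := hφ.of_le (by exact_mod_cast le_top)
  refine ⟨_, toLp_mem_timeDerivGraph hφ1 hφc, ?_⟩
  exact Lp.ext ((memLp_timeMeasure hφ1.continuous hφc).coeFn_toLp.trans hf.symm)

/-- The identity `Re ⟨u, u'⟩ = ρ ‖u‖²` survives the closure, so the accretivity criterion with
constant `ρ` shows that `d/dt` is closable. -/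
lemma timeDeriv_graph : (timeDeriv ρ H).graph = (timeDerivGraph ρ H).topologicalClosure :=
  graph_closure_toLinearPMap <| snd_eq_zero_of_accretive (c := ρ)
    (fun _ hp => (timeDerivGraph_closure_re_inner hp).ge)
    (dense_image_mono _ (Submodule.le_topologicalClosure _) dense_timeDerivGraph_fst)

/-- Pointwise application of a bounded operator commutes with the time derivative. -/
lemma compLpL_mem_timeDeriv_graph (L : H →L[ℂ] H) {p : HRho ρ H × HRho ρ H}
    (hp : p ∈ (timeDeriv ρ H).graph) :
    (L.compLpL 2 (timeMeasure ρ) p.1, L.compLpL 2 (timeMeasure ρ) p.2) ∈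
      (timeDeriv ρ H).graph := by
  rw [timeDeriv_graph] at hp ⊢
  have hcont : Continuous fun p : HRho ρ H × HRho ρ H =>
      (L.compLpL 2 (timeMeasure ρ) p.1, L.compLpL 2 (timeMeasure ρ) p.2) := by fun_prop
  refine map_mem_closure (f := fun p : HRho ρ H × HRho ρ H =>
      (L.compLpL 2 (timeMeasure ρ) p.1, L.compLpL 2 (timeMeasure ρ) p.2)) hcont hp ?_
  rintro ⟨u, v⟩ ⟨φ, hφ, hφc, h1, h2⟩
  refine ⟨fun t => L (φ t), ?_, hφc.comp_left (map_zero L), ?_, ?_⟩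
  · exact (L.restrictScalars ℝ).contDiff.comp hφ
  · filter_upwards [L.coeFn_compLpL u, h1] with t h3 h4
    rw [h3, h4]
  · filter_upwards [L.coeFn_compLpL v, h2] with t h3 h4
    rw [h3, h4]
    exact (((L.restrictScalars ℝ).hasFDerivAt.comp_hasDerivAt t
      (hφ.differentiable one_ne_zero t).hasDerivAt).deriv).symm

/-- The equation `u' + a u = f` has a compactly supported solution if
`∫ exp (a s) f(s) ds = 0`. -/
lemma exists_compactSupport_solution [CompleteSpace H] (a : ℝ) {f : ℝ → H} (hf : Continuous f)
    (hfc : HasCompactSupport f) (hint : ∫ s, Real.exp (a * s) • f s = 0) :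
    ∃ u : ℝ → H, ContDiff ℝ 1 u ∧ HasCompactSupport u ∧ ∀ t, deriv u t + a • u t = f t := by
  set g : ℝ → H := fun s => Real.exp (a * s) • f s with hg
  have hgc : Continuous g := by fun_prop
  obtain ⟨L, hL⟩ := hfc.isCompact.isBounded.subset_closedBall 0
  have hg0 : ∀ s, L < |s| → g s = 0 := by
    intro s hs
    have : f s = 0 := by
      by_contra h
      have := hL (subset_tsupport f h)
      rw [mem_closedBall_zero_iff, Real.norm_eq_abs] at this
      linarith
    rw [hg]; simp [this]
  -- `L'` is positive and strictly larger than `L`, even if `L` is negative; the half-open interval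
  -- from `-L'` then contains the support of `g`.
  set L' := |L| + 1
  have hL' : L < L' := (le_abs_self L).trans_lt (lt_add_one _)
  have hL'0 : 0 < L' := by positivity
  -- Variation of constants: the solution is `exp (-a t) G t`. The primitive `G` vanishes to the
  -- left of the support, and to the right of it by the integral condition.
  set G : ℝ → H := fun t => ∫ s in (-L')..t, g s with hG
  have hGd : ∀ t, HasDerivAt G (g t) t := fun t =>
    (hgc.integral_hasStrictDerivAt (-L') t).hasDerivAt
  have hG0 : ∀ t, t ∉ Set.Icc (-L') L' → G t = 0 := by
    intro t ht
    rw [Set.mem_Icc, not_and_or, not_le, not_le] at ht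
    rcases ht with ht | ht
    · rw [hG]
      dsimp only
      rw [intervalIntegral.integral_symm, intervalIntegral.integral_congr (g := fun _ => 0),
        intervalIntegral.integral_zero, neg_zero]
      intro s hs
      rw [Set.uIcc_of_le ht.le] at hs
      refine hg0 s ?_
      rw [abs_of_neg (by linarith [hs.2])]
      linarith [hs.2]
    · rw [hG]
      dsimp only
      rw [intervalIntegral.integral_eq_integral_of_support_subset, hint]
      intro s hs
      have : |s| ≤ L := by
        by_contra! h
        exact hs (hg0 s h)
      rw [abs_le] at this
      exact ⟨by linarith, by linarith⟩
  have hd : ∀ t, HasDerivAt (fun t => Real.exp (-a * t) • G t)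
      (f t - a • (Real.exp (-a * t) • G t)) t := by
    intro t
    have d3 : HasDerivAt (fun t : ℝ => Real.exp (-a * t)) (Real.exp (-a * t) * (-a)) t := by
      simpa using ((hasDerivAt_id t).const_mul (-a)).exp
    refine (d3.smul (hGd t)).congr_deriv ?_
    rw [hg]
    dsimp only
    rw [smul_smul, ← Real.exp_add, smul_smul]
    have : -a * t + a * t = 0 := by ring
    rw [this, Real.exp_zero, one_smul, sub_eq_add_neg, ← neg_smul]
    congr 2
    ring
  have hderiv : deriv (fun t => Real.exp (-a * t) • G t) =
      fun t => f t - a • (Real.exp (-a * t) • G t) := funext fun t => (hd t).deriv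
  have hGcont : Continuous G := continuous_iff_continuousAt.2 fun t => (hGd t).continuousAt
  refine ⟨fun t => Real.exp (-a * t) • G t, ?_, ?_, fun t => ?_⟩
  · rw [contDiff_one_iff_deriv, hderiv]
    exact ⟨fun t => (hd t).differentiableAt, by fun_prop⟩
  · exact HasCompactSupport.intro (K := Set.Icc (-L') L') isCompact_Icc fun t ht => by
      simp [hG0 t ht]
  · rw [hderiv, sub_add_cancel]

/-- Translation of a function in `H_ρ(ℝ, H)` by `T` multiplies its norm by `exp (-ρ T)`. -/
lemma norm_toLp_translate {φ : ℝ → H} (hφ : MemLp φ 2 (timeMeasure ρ)) (T : ℝ)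
    (hφT : MemLp (fun t => φ (t - T)) 2 (timeMeasure ρ)) :
    ‖hφT.toLp‖ = Real.exp (-ρ * T) * ‖hφ.toLp‖ := by
  have key : (inner ℂ hφT.toLp hφT.toLp : ℂ) =
      Real.exp (-2 * ρ * T) • (inner ℂ hφ.toLp hφ.toLp : ℂ) := by
    rw [inner_HRho hφT.coeFn_toLp hφT.coeFn_toLp, inner_HRho hφ.coeFn_toLp hφ.coeFn_toLp,
      
      ← integral_sub_right_eq_self
        (fun t => Real.exp (-2 * ρ * t) • (inner ℂ (φ t) (φ t) : ℂ)) T, ← integral_smul]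
    refine integral_congr_ae (Eventually.of_forall fun t => ?_)
    dsimp only
    rw [smul_smul, ← Real.exp_add]
    congr 3
    ring
  have h2 := congrArg Complex.re key
  rw [Complex.real_smul, Complex.re_ofReal_mul, ← norm_sq_eq_re_inner', ← norm_sq_eq_re_inner',
    show -2 * ρ * T = -ρ * T + -ρ * T by ring, Real.exp_add, ← sq, ← mul_pow] at h2
  exact (pow_left_inj₀ (norm_nonneg _) (by positivity) two_ne_zero).1 h2

/-- `d/dt + a` on compactly supported functions has dense range, unless `a = -ρ`. -/
lemma dense_range_timeDeriv_add [CompleteSpace H] {a : ℝ} (ha : a + ρ ≠ 0) :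
    Dense ((fun p : HRho ρ H × HRho ρ H => p.2 + (a : ℂ) • p.1) ''
      (timeDerivGraph ρ H : Set _)) := by
  refine dense_closure.1 (Dense.mono ?_ (Lp.dense_hasCompactSupport_contDiff (F := H)
    (μ := timeMeasure ρ) (p := 2) ENNReal.ofNat_ne_top))
  rintro F ⟨f, hF, hfc, hf⟩
  have hf0 : Continuous f := hf.continuous
  let b : ContDiffBump (0 : ℝ) := ⟨1, 2, by norm_num, by norm_num⟩
  have hb : Continuous b := b.continuous
  have hbc : HasCompactSupport b := b.hasCompactSupport
  set κ : ℝ := ∫ s, Real.exp (a * s) * b s with hκ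
  have hκ0 : κ ≠ 0 := by
    refine ne_of_gt (Continuous.integral_pos_of_hasCompactSupport_nonneg_nonzero (x := 0)
      (by fun_prop) (hbc.mul_left (f := fun s => Real.exp (a * s)))
      (fun s => mul_nonneg (Real.exp_nonneg _) b.nonneg) ?_)
    simp [b.one_of_mem_closedBall (show (0 : ℝ) ∈ Metric.closedBall 0 b.rIn by simp [b])]
  -- `C` is chosen so that `b • C` has the same integral against `exp (a s)` as `f`. Its translate
  -- by `T`, times `exp (-a T)`, keeps that integral, so subtracting it makes the equation solvable
  -- with compact support.
  set C : H := κ⁻¹ • ∫ s, Real.exp (a * s) • f s with hC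
  have hψ : Continuous fun t => b t • C := by fun_prop
  have hψc : HasCompactSupport fun t => b t • C := hbc.smul_right (f' := fun _ => C)
  have htrans : ∀ T : ℝ, HasCompactSupport fun t => b (t - T) • C := fun T =>
    hψc.comp_homeomorph (Homeomorph.subRight T)
  have hm : ∀ T : ℝ, MemLp (fun t => b (t - T) • C) 2 (timeMeasure ρ) := fun T =>
    memLp_timeMeasure (by fun_prop) (htrans T)
  have hmf : MemLp f 2 (timeMeasure ρ) := memLp_timeMeasure hf0 hfc
  have hFf : F = hmf.toLp := Lp.ext (hF.trans hmf.coeFn_toLp.symm)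
  have hmem : ∀ T : ℝ, F - (Real.exp (-a * T) : ℂ) • (hm T).toLp ∈
      (fun p : HRho ρ H × HRho ρ H => p.2 + (a : ℂ) • p.1) '' (timeDerivGraph ρ H : Set _) := by
    intro T
    have hc1 : HasCompactSupport fun t => Real.exp (-a * T) • (b (t - T) • C) :=
      (htrans T).smul_left (f := fun _ => Real.exp (-a * T))
    obtain ⟨u, hu, huc, hu'⟩ := exists_compactSupport_solution a
      (f := fun t => f t - Real.exp (-a * T) • (b (t - T) • C)) (by fun_prop) (hfc.sub hc1) (by
        have e1 : ∫ s, Real.exp (a * s) • (Real.exp (-a * T) • (b (s - T) • C)) =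
            ∫ s, Real.exp (a * s) • f s := by
          rw [← integral_add_right_eq_self _ T]
          have e2 : ∀ s, Real.exp (a * (s + T)) • (Real.exp (-a * T) • (b (s + T - T) • C)) =
              (Real.exp (a * s) * b s) • C := by
            intro s
            rw [smul_smul, smul_smul, ← Real.exp_add, add_sub_cancel_right]
            congr 3
            ring
          simp_rw [e2]
          rw [integral_smul_const, ← hκ, hC, smul_inv_smul₀ hκ0]
        simp_rw [smul_sub]
        rw [integral_sub, e1, sub_self]
        · exact Continuous.integrable_of_hasCompactSupport (by fun_prop)
            (hfc.smul_left (f := fun s => Real.exp (a * s)))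
        · exact Continuous.integrable_of_hasCompactSupport (by fun_prop)
            (hc1.smul_left (f := fun s => Real.exp (a * s))))
    refine ⟨_, toLp_mem_timeDerivGraph hu huc, Lp.ext ?_⟩
    dsimp only
    filter_upwards [Lp.coeFn_add ((memLp_timeMeasure (ρ := ρ) (hu.continuous_deriv le_rfl)
        huc.deriv).toLp (deriv u)) ((a : ℂ) • (memLp_timeMeasure hu.continuous huc).toLp u),
      Lp.coeFn_smul (a : ℂ) ((memLp_timeMeasure (ρ := ρ) hu.continuous huc).toLp u),
      MemLp.coeFn_toLp (memLp_timeMeasure (ρ := ρ) hu.continuous huc),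
      MemLp.coeFn_toLp (memLp_timeMeasure (ρ := ρ) (hu.continuous_deriv le_rfl) huc.deriv),
      Lp.coeFn_sub F ((Real.exp (-a * T) : ℂ) • (hm T).toLp),
      Lp.coeFn_smul (Real.exp (-a * T) : ℂ) (hm T).toLp, hF, (hm T).coeFn_toLp] with
      t h1 h2 h3 h4 h5 h6 h7 h8
    rw [h1, h5, Pi.add_apply, Pi.sub_apply, h2, h6, Pi.smul_apply, Pi.smul_apply, h3, h4, h7, h8,
      Complex.coe_smul, Complex.coe_smul, hu']
  -- The correction has norm proportional to `exp (-(a + ρ) T)`; translating by `T = n / (a + ρ)`,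
  -- to the right or to the left, makes this `exp (-n)`.
  have hlim : Tendsto (fun n : ℕ => F - (Real.exp (-a * (n / (a + ρ))) : ℂ) •
      (hm (n / (a + ρ))).toLp) atTop (𝓝 F) := by
    rw [tendsto_iff_norm_sub_tendsto_zero]
    have hm0 := memLp_timeMeasure (ρ := ρ) hψ hψc
    have e : ∀ n : ℕ, ‖F - (Real.exp (-a * (n / (a + ρ))) : ℂ) • (hm (n / (a + ρ))).toLp - F‖ =
        Real.exp (-n) * ‖hm0.toLp‖ := by
      intro n
      rw [sub_sub_cancel_left, norm_neg, norm_smul, norm_toLp_translate hm0, ← mul_assoc,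
        Complex.norm_real, Real.norm_of_nonneg (Real.exp_nonneg _), ← Real.exp_add]
      congr 2
      field_simp
      ring
    simp_rw [e]
    simpa using ((Real.tendsto_exp_neg_atTop_nhds_zero.comp
      tendsto_natCast_atTop_atTop).mul_const ‖hm0.toLp‖)
  exact mem_closure_of_tendsto hlim (Eventually.of_forall fun n => hmem _)

/-- The resolvents of the time derivative. -/
lemma exists_timeDeriv_resolvent [CompleteSpace H] {a σ : ℝ} (hσ : σ * σ = 1)
    (ha : 0 < σ * (a + ρ)) :
    ∃ Q : HRho ρ H →L[ℂ] HRho ρ H, ‖Q‖ ≤ 1 / (σ * (a + ρ)) ∧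
      (∀ u f, (u, f) ∈ (timeDeriv ρ H).graph → Q (f + (a : ℂ) • u) = u) ∧
      ∀ y, (Q y, y - (a : ℂ) • Q y) ∈ (timeDeriv ρ H).graph := by
  have hσ' : (σ : ℂ) * σ = 1 := by exact_mod_cast hσ
  -- The preimage of the graph under `Φ` is the graph of `σ (∂₀ + a)`, where the sign `σ = ±1` makes
  -- the accretivity constant `σ (a + ρ)` positive.
  let Φ : HRho ρ H × HRho ρ H →L[ℂ] HRho ρ H × HRho ρ H :=
    (ContinuousLinearMap.fst ℂ _ _).prod
      ((σ : ℂ) • ContinuousLinearMap.snd ℂ _ _ - (a : ℂ) • ContinuousLinearMap.fst ℂ _ _)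
  have hΦ : ∀ u h, Φ (u, h) = (u, (σ : ℂ) • h - (a : ℂ) • u) := fun _ _ => rfl
  have hσσ : ∀ x : HRho ρ H, (σ : ℂ) • (σ : ℂ) • x = x := fun x => by
    rw [smul_smul, hσ', one_smul]
  obtain ⟨S, hS, hSG⟩ := exists_boundedInverse
    (G := (timeDeriv ρ H).graph.comap (Φ : HRho ρ H × HRho ρ H →ₗ[ℂ] HRho ρ H × HRho ρ H))
    (by
      have : IsClosed ((timeDeriv ρ H).graph : Set (HRho ρ H × HRho ρ H)) := by
        rw [timeDeriv_graph]
        exact Submodule.isClosed_topologicalClosure _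
      exact this.preimage Φ.continuous) ha
    (by
      rintro ⟨u, h⟩ hp
      have hp' : (u, (σ : ℂ) • h - (a : ℂ) • u) ∈ (timeDeriv ρ H).graph := hp
      rw [timeDeriv_graph] at hp'
      have h1 := timeDerivGraph_closure_re_inner hp'
      simp only [inner_sub_right, inner_smul_right, Complex.sub_re, Complex.re_ofReal_mul,
        ← norm_sq_eq_re_inner'] at h1
      dsimp only
      apply le_of_eq
      linear_combination (-σ) * h1 + (inner ℂ u h).re * hσ)
    (by
      have h1 : Dense ((fun x : HRho ρ H => (σ : ℂ) • x) ''
          ((fun p : HRho ρ H × HRho ρ H => p.2 + (a : ℂ) • p.1) ''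
          (timeDerivGraph ρ H : Set _))) :=
        DenseRange.dense_image (Function.Surjective.denseRange fun x => ⟨_, hσσ x⟩)
          (continuous_const_smul _) (dense_range_timeDeriv_add fun h => by simp [h] at ha)
      refine Dense.mono ?_ h1
      rintro _ ⟨_, ⟨⟨u, f⟩, hp, rfl⟩, rfl⟩
      refine ⟨(u, (σ : ℂ) • (f + (a : ℂ) • u)), ?_, rfl⟩
      change Φ _ ∈ (timeDeriv ρ H).graph
      rw [hΦ, hσσ, add_sub_cancel_right, timeDeriv_graph]
      exact Submodule.le_topologicalClosure _ hp)
  have hσn : ‖(σ : ℂ)‖ = 1 := by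
    rw [Complex.norm_real, Real.norm_eq_abs]
    have := abs_mul_abs_self σ
    nlinarith [abs_nonneg σ]
  refine ⟨(σ : ℂ) • S, by rwa [norm_smul, hσn, one_mul], fun u f h => ?_, fun y => ?_⟩
  · rw [smul_apply, ← map_smul]
    refine (hSG _ _).1 ?_
    change Φ _ ∈ (timeDeriv ρ H).graph
    rwa [hΦ, hσσ, add_sub_cancel_right]
  · rw [smul_apply, ← map_smul]
    have h := (hSG (S ((σ : ℂ) • y)) ((σ : ℂ) • y)).2 rfl
    change Φ _ ∈ (timeDeriv ρ H).graph at h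
    rwa [hΦ, hσσ] at h

/-- The inverse of the time derivative, and regularizing operators which commute with it. -/
theorem exists_timeDeriv_inverse [CompleteSpace H] (hρ : 0 < ρ) :
    ∃ (P : HRho ρ H →L[ℂ] HRho ρ H) (R W : ℕ → HRho ρ H →L[ℂ] HRho ρ H),
      IsNormalInverse (2 * ρ) P ∧ (∀ u d, (u, d) ∈ (timeDeriv ρ H).graph ↔ P d = u) ∧
      (∀ x, Tendsto (fun n => R n x) atTop (𝓝 x)) ∧ (∀ n x, R n x = P (W n x)) ∧
      (∀ n x, R n (P x) = P (R n x)) ∧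
      ∀ L : H →L[ℂ] H, (∀ x, L.compLpL 2 (timeMeasure ρ) (P x) =
          P (L.compLpL 2 (timeMeasure ρ) x)) ∧
        ∀ n x, R n (L.compLpL 2 (timeMeasure ρ) x) = L.compLpL 2 (timeMeasure ρ) (R n x) := by
  obtain ⟨P, -, hP1, hP2⟩ := exists_timeDeriv_resolvent (ρ := ρ) (H := H) (a := 0) (σ := 1)
    (by norm_num) (by simpa using hρ)
  obtain ⟨Q, -, hQ1, hQ2⟩ := exists_timeDeriv_resolvent (ρ := ρ) (H := H) (a := -(2 * ρ))
    (σ := -1) (by norm_num) (by linarith)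
  simp only [Complex.ofReal_zero, zero_smul, add_zero, sub_zero] at hP1 hP2
  have hPi : ∀ u d, (u, d) ∈ (timeDeriv ρ H).graph ↔ P d = u := fun u d =>
    ⟨hP1 u d, by rintro rfl; exact hP2 d⟩
  -- `Q = (∂₀ - 2ρ)⁻¹`, so this is `∂₀* = 2ρ - ∂₀` for the inverses. It follows from integration by
  -- parts since `∂₀ - 2ρ` is onto.
  have hadj : ∀ y, P.adjoint y = -Q y := by
    intro y
    refine ext_inner_left ℂ fun x => ?_
    rw [ContinuousLinearMap.adjoint_inner_right]
    have h1 := hP2 x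
    have h2 := hQ2 y
    rw [timeDeriv_graph] at h1 h2
    have h := timeDerivGraph_closure_inner h1 h2
    simp only [inner_sub_right, inner_smul_right] at h
    rw [inner_neg_right]
    push_cast at h
    linear_combination h
  have hn : IsNormalInverse (2 * ρ) P := by
    refine ⟨fun x hx => ?_, fun x => ?_, fun x => ?_⟩
    · have h := hP2 x
      rw [hx] at h
      exact (timeDeriv ρ H).graph_fst_eq_zero_snd h rfl
    · rw [hadj, hadj]
      have h := hQ1 _ _ (hP2 x)
      rw [map_add, map_smul] at h
      nth_rewrite 1 [← h]
      push_cast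
      module
    · rw [hadj, map_neg]
      have h := hP1 _ _ (hQ2 x)
      rw [map_sub, map_smul] at h
      nth_rewrite 1 [← h]
      push_cast
      module
  have hres : ∀ n : ℕ, ∃ Q : HRho ρ H →L[ℂ] HRho ρ H, ‖Q‖ ≤ 1 / (1 * ((n + 1 : ℝ) + ρ)) ∧
      (∀ u f, (u, f) ∈ (timeDeriv ρ H).graph → Q (f + ((n + 1 : ℝ) : ℂ) • u) = u) ∧
      ∀ y, (Q y, y - ((n + 1 : ℝ) : ℂ) • Q y) ∈ (timeDeriv ρ H).graph := fun n =>
    exists_timeDeriv_resolvent (by norm_num) (by positivity)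
  choose V hV0 hV1 hV2 using hres
  have hLP : ∀ (L : H →L[ℂ] H) x, L.compLpL 2 (timeMeasure ρ) (P x) =
      P (L.compLpL 2 (timeMeasure ρ) x) := fun L x =>
    (hP1 _ _ (compLpL_mem_timeDeriv_graph L (hP2 x))).symm
  have hVP : ∀ n x, V n (P x) = P (V n x) := by
    intro n x
    have h1 := hP1 _ _ (hV2 n x)
    have h2 := hV1 n _ _ (hP2 (V n x))
    rw [map_sub, map_smul, sub_eq_iff_eq_add] at h1
    rw [h1]
    exact h2
  have hVlim : ∀ x, Tendsto (fun n => V n x) atTop (𝓝 0) := by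
    intro x
    have h1 : Tendsto (fun n : ℕ => 1 / ((n : ℝ) + 1) * ‖x‖) atTop (𝓝 0) := by
      simpa using tendsto_one_div_add_atTop_nhds_zero_nat.mul_const ‖x‖
    refine squeeze_zero_norm (fun n => ?_) h1
    refine (V n).le_of_opNorm_le ((hV0 n).trans ?_) x
    rw [one_mul]
    exact one_div_le_one_div_of_le (by positivity) (by linarith)
  have hRP : ∀ (n : ℕ) x, ((n + 1 : ℝ) : ℂ) • V n (P x) = P x - V n x := by
    intro n x
    have h := hV1 n _ _ (hP2 x)
    rw [map_add, map_smul] at h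
    rw [eq_sub_iff_add_eq, add_comm, h]
  have hRn : ∀ (n : ℕ) x, ‖((n + 1 : ℝ) : ℂ) • V n x‖ ≤ ‖x‖ := by
    intro n x
    rw [norm_smul, Complex.norm_real, Real.norm_of_nonneg (by positivity)]
    have h1 := (V n).le_of_opNorm_le (hV0 n) x
    calc (n + 1 : ℝ) * ‖V n x‖ ≤ (n + 1 : ℝ) * (1 / (1 * ((n + 1 : ℝ) + ρ)) * ‖x‖) := by gcongr
      _ = ((n + 1 : ℝ) / ((n + 1 : ℝ) + ρ)) * ‖x‖ := by field_simp
      _ ≤ 1 * ‖x‖ := by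
        gcongr
        rw [div_le_one (by positivity)]
        linarith
      _ = ‖x‖ := one_mul _
  have hPdense : DenseRange P := dense_range_of_inner_eq_zero _ fun g hg =>
    hn.adjoint_injective g <| ext_inner_right ℂ fun z => by
      rw [ContinuousLinearMap.adjoint_inner_left, hg, inner_zero_left]
  -- Yosida regularization: with `V n = (∂₀ + n + 1)⁻¹`, take `R n = (n + 1) V n` and `W n = ∂₀ R
  -- n`.
  refine ⟨P, fun n => ((n + 1 : ℝ) : ℂ) • V n,
    fun n => ((n + 1 : ℝ) : ℂ) • (ContinuousLinearMap.id ℂ _ - ((n + 1 : ℝ) : ℂ) • V n),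
    hn, hPi, fun x => ?_, fun n x => ?_, fun n x => ?_, fun L => ⟨hLP L, fun n x => ?_⟩⟩
  · rw [Metric.tendsto_nhds]
    intro ε hε
    obtain ⟨z, hz⟩ := hPdense.exists_dist_lt x (show 0 < ε / 3 by positivity)
    filter_upwards [Metric.tendsto_nhds.1 (hVlim z) (ε / 3) (by positivity)] with n hn'
    rw [dist_zero_right] at hn'
    rw [dist_eq_norm] at hz ⊢
    -- On the dense range of `P` one has `R n (P z) - P z = -V n z → 0`; the remainder is controlled
    -- by `‖R n‖ ≤ 1`.
    have e : (((n + 1 : ℝ) : ℂ) • V n) x - x =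
        ((n + 1 : ℝ) : ℂ) • V n (x - P z) - V n z - (x - P z) := by
      rw [map_sub, smul_sub, hRP, smul_apply]
      module
    rw [e]
    have h1 := norm_sub_le (((n + 1 : ℝ) : ℂ) • V n (x - P z) - V n z) (x - P z)
    have h2 := norm_sub_le (((n + 1 : ℝ) : ℂ) • V n (x - P z)) (V n z)
    have h3 := hRn n (x - P z)
    linarith
  · rw [smul_apply, smul_apply, map_smul, sub_apply, ContinuousLinearMap.id_apply, smul_apply,
      hP1 _ _ (hV2 n x)]
  · rw [smul_apply, smul_apply, map_smul, hVP]
  · rw [smul_apply, smul_apply, map_smul]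
    have h := hV1 n _ _ (compLpL_mem_timeDeriv_graph L (hV2 n x))
    dsimp only at h
    rw [map_sub, map_smul, sub_add_cancel] at h
    rw [h]

end TimeDerivative

/-! ### Skew-selfadjoint operators and their resolvent -/

section SkewSelfAdjoint

variable {H : Type*} [NormedAddCommGroup H] [InnerProductSpace ℂ H]

lemma mem_neg_graph_iff {A : H →ₗ.[ℂ] H} {x y : H} : (x, y) ∈ (-A).graph ↔ (x, -y) ∈ A.graph := by
  rw [LinearPMap.mem_graph_iff, LinearPMap.mem_graph_iff]
  constructor
  · rintro ⟨z, hz, h⟩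
    refine ⟨z, hz, ?_⟩
    rw [LinearPMap.neg_apply] at h
    dsimp only at h ⊢
    rw [← h, neg_neg]
  · rintro ⟨z, hz, h⟩
    refine ⟨z, hz, ?_⟩
    rw [LinearPMap.neg_apply]
    dsimp only at h ⊢
    rw [h, neg_neg]

variable [CompleteSpace H]

/-- This is `A = -A*` written out on graphs. The implication from right to left is the maximality of
`A`, by which weak solutions are shown to lie in the domain. -/
lemma IsSkewSelfAdjoint.mem_graph_iff {A : H →ₗ.[ℂ] H} (hA : IsSkewSelfAdjoint A) {x y : H} :
    (x, y) ∈ A.graph ↔ ∀ a b, (a, b) ∈ A.graph → inner ℂ b x + inner ℂ a y = 0 := by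
  have h := LinearPMap.adjoint_graph_eq_graph_adjoint hA.1
  rw [hA.2] at h
  have h1 : (x, y) ∈ A.graph ↔ (x, -y) ∈ (-A).graph := by rw [mem_neg_graph_iff, neg_neg]
  rw [h1, h, Submodule.mem_adjoint_iff]
  simp only [inner_neg_right, sub_neg_eq_add]

lemma IsSkewSelfAdjoint.isClosed_graph {A : H →ₗ.[ℂ] H} (hA : IsSkewSelfAdjoint A) :
    IsClosed (A.graph : Set (H × H)) := by
  have h : IsClosed ((A†).graph : Set (H × H)) := LinearPMap.adjoint_isClosed hA.1
  rw [hA.2] at h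
  have h2 : (A.graph : Set (H × H)) = (fun p : H × H => (p.1, -p.2)) ⁻¹' ((-A).graph : Set _) := by
    ext ⟨x, y⟩
    simp only [Set.mem_preimage, SetLike.mem_coe]
    rw [mem_neg_graph_iff, neg_neg]
  rw [h2]
  exact h.preimage (by fun_prop)

lemma IsSkewSelfAdjoint.re_inner {A : H →ₗ.[ℂ] H} (hA : IsSkewSelfAdjoint A) {x y : H}
    (h : (x, y) ∈ A.graph) : (inner ℂ x y).re = 0 := by
  have h1 := congrArg Complex.re (hA.mem_graph_iff.1 h x y h)
  rw [Complex.add_re, re_inner_comm y, Complex.zero_re] at h1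
  linarith

/-- The operator `(1 + A)⁻¹` of a skew-selfadjoint operator `A`. -/
theorem IsSkewSelfAdjoint.exists_resolvent {A : H →ₗ.[ℂ] H} (hA : IsSkewSelfAdjoint A) :
    ∃ J : H →L[ℂ] H, IsNormalInverse 2 J ∧ ∀ x y, (x, y) ∈ A.graph ↔ J (x + y) = x := by
  let Φ : H × H →L[ℂ] H × H := (ContinuousLinearMap.fst ℂ H H).prod
    (ContinuousLinearMap.snd ℂ H H - ContinuousLinearMap.fst ℂ H H)
  have hΦ : ∀ u h, Φ (u, h) = (u, h - u) := fun _ _ => rfl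
  obtain ⟨J, -, hJ⟩ := exists_boundedInverse (c := 1)
    (G := A.graph.comap (Φ : H × H →ₗ[ℂ] H × H)) (hA.isClosed_graph.preimage Φ.continuous)
    one_pos
    (by
      rintro ⟨u, h⟩ hp
      have h1 := hA.re_inner (show (u, h - u) ∈ A.graph from hp)
      rw [inner_sub_right, Complex.sub_re, ← norm_sq_eq_re_inner'] at h1
      dsimp only
      linarith)
    (by
      have himg : Prod.snd '' (A.graph.comap (Φ : H × H →ₗ[ℂ] H × H) : Set (H × H)) =
          ((A.graph.comap (Φ : H × H →ₗ[ℂ] H × H)).map (LinearMap.snd ℂ H H) : Set H) := rfl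
      rw [himg, Submodule.dense_iff_topologicalClosure_eq_top,
        Submodule.topologicalClosure_eq_top_iff, Submodule.eq_bot_iff]
      intro g hg
      rw [Submodule.mem_orthogonal] at hg
      -- A vector orthogonal to the range of `1 + A` satisfies `A g = g`, which contradicts `Re ⟨g,
      -- A g⟩ = 0` unless `g = 0`.
      have h1 : (g, g) ∈ A.graph := by
        rw [hA.mem_graph_iff]
        intro a b hab
        rw [← inner_add_left]
        refine hg _ ⟨(a, b + a), ?_, rfl⟩
        change Φ _ ∈ A.graph
        rwa [hΦ, add_sub_cancel_right]
      have h2 := hA.re_inner h1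
      rw [← norm_sq_eq_re_inner'] at h2
      simpa using h2)
  have hJ' : ∀ x y, (x, y) ∈ A.graph ↔ J (x + y) = x := by
    intro x y
    rw [← hJ]
    change _ ↔ Φ _ ∈ A.graph
    rw [hΦ, add_sub_cancel_left]
  have hJ1 : ∀ x, (J x, x - J x) ∈ A.graph := fun x => by rw [hJ', add_sub_cancel]
  -- Together with `hJ3` this identifies `J*` as `(1 - A)⁻¹`.
  have hJ2 : ∀ y, (J.adjoint y, J.adjoint y - y) ∈ A.graph := by
    intro y
    rw [hA.mem_graph_iff]
    intro a b hab
    rw [inner_sub_right, ContinuousLinearMap.adjoint_inner_right,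
      ContinuousLinearMap.adjoint_inner_right, ← add_sub_assoc, ← inner_add_left, ← map_add,
      add_comm b, (hJ' a b).1 hab, sub_self]
  have hJ3 : ∀ x y, (x, y) ∈ A.graph → J.adjoint (x - y) = x := by
    intro x y h
    refine ext_inner_left ℂ fun z => ?_
    have h1 := hA.mem_graph_iff.1 h _ _ (hJ1 z)
    rw [inner_sub_left] at h1
    rw [ContinuousLinearMap.adjoint_inner_right, inner_sub_right]
    linear_combination -h1
  refine ⟨J, ⟨fun x hx => ?_, fun x => ?_, fun x => ?_⟩, hJ'⟩
  · have h := hJ1 x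
    rw [hx, sub_zero] at h
    exact A.graph_fst_eq_zero_snd h rfl
  · have h := hJ3 _ _ (hJ1 x)
    rw [map_sub, map_sub] at h
    nth_rewrite 1 [← h]
    push_cast
    module
  · have h := (hJ' _ _).1 (hJ2 x)
    rw [map_add, map_sub] at h
    nth_rewrite 1 [← h]
    push_cast
    module

end SkewSelfAdjoint

/-! ### Bounded operators acting pointwise on square integrable functions -/

section Pointwise

variable {α : Type*} [MeasurableSpace α] {μ : Measure α}
  {H : Type*} [NormedAddCommGroup H] [InnerProductSpace ℂ H]

lemma compLpL_comp_apply (L L' : H →L[ℂ] H) (u : Lp H 2 μ) :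
    L.compLpL 2 μ (L'.compLpL 2 μ u) = (L ∘L L').compLpL 2 μ u := by
  refine Lp.ext ?_
  filter_upwards [L.coeFn_compLpL (L'.compLpL 2 μ u), L'.coeFn_compLpL u,
    (L ∘L L').coeFn_compLpL u] with t h1 h2 h3
  rw [h1, h2, h3]
  rfl

lemma norm_sq_L2 (u : Lp H 2 μ) : ‖u‖ ^ 2 = ∫ t, ‖u t‖ ^ 2 ∂μ := by
  have h : Integrable (fun t => (inner ℂ (u t) (u t) : ℂ)) μ := L2.integrable_inner u u
  rw [norm_sq_eq_re_inner', L2.inner_def]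
  have h1 := integral_re h
  simp only [RCLike.re_eq_complex_re] at h1
  rw [← h1]
  simp_rw [norm_sq_eq_re_inner']

lemma ReGE.compLpL {B : H →L[ℂ] H} {c : ℝ} (hB : ReGE B c) : ReGE (B.compLpL 2 μ) c := by
  intro u
  have h : Integrable (fun t => (inner ℂ (u t) (B.compLpL 2 μ u t) : ℂ)) μ :=
    L2.integrable_inner u _
  have h1 := integral_re h
  simp only [RCLike.re_eq_complex_re] at h1
  rw [norm_sq_L2, L2.inner_def, ← h1, ← integral_const_mul]
  refine integral_mono_ae ?_ h.re ?_
  · exact ((memLp_two_iff_integrable_sq_norm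
      (Lp.aestronglyMeasurable u)).1 (Lp.memLp u)).const_mul _
  · filter_upwards [B.coeFn_compLpL u] with t ht
    rw [ht]
    exact hB (u t)

variable [CompleteSpace H]

lemma compLpL_adjoint (L : H →L[ℂ] H) :
    (L.compLpL 2 μ).adjoint = (L.adjoint).compLpL 2 μ := by
  symm
  rw [ContinuousLinearMap.eq_adjoint_iff]
  intro u v
  rw [L2.inner_def, L2.inner_def]
  refine integral_congr_ae ?_
  filter_upwards [L.coeFn_compLpL v, (L.adjoint).coeFn_compLpL u] with t h1 h2
  rw [h1, h2, ContinuousLinearMap.adjoint_inner_left]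

lemma isSelfAdjoint_compLpL {M : H →L[ℂ] H} (hM : IsSelfAdjoint M) :
    IsSelfAdjoint (M.compLpL 2 μ) := by
  rw [ContinuousLinearMap.isSelfAdjoint_iff', compLpL_adjoint, hM.adjoint_eq]

lemma IsNormalInverse.compLpL {κ : ℝ} {J : H →L[ℂ] H} (hJ : IsNormalInverse κ J) :
    IsNormalInverse κ (J.compLpL 2 μ) := by
  refine ⟨fun u hu => ?_, fun u => ?_, fun u => ?_⟩
  · refine (Lp.eq_zero_iff_ae_eq_zero).2 ?_
    have h := (Lp.eq_zero_iff_ae_eq_zero).1 hu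
    filter_upwards [h, J.coeFn_compLpL u] with t h1 h2
    rw [h2] at h1
    exact hJ.injective _ h1
  · rw [compLpL_adjoint, compLpL_comp_apply, ← add_apply, ← ContinuousLinearMap.add_compLpL,
      ← smul_apply, ← ContinuousLinearMap.smul_compLpL]
    congr 2
    ext x
    exact hJ.adjoint_mul x
  · rw [compLpL_adjoint, compLpL_comp_apply, ← add_apply, ← ContinuousLinearMap.add_compLpL,
      ← smul_apply, ← ContinuousLinearMap.smul_compLpL]
    congr 2
    ext x
    exact hJ.mul_adjoint x

/-- Strong convergence of bounded operators lifts to their pointwise application. -/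
lemma tendsto_compLpL {ι : Type*} {l : Filter ι} [l.IsCountablyGenerated]
    {M : ι → H →L[ℂ] H} {M₀ : H →L[ℂ] H} (hM : ∀ x, Tendsto (fun s => M s x) l (𝓝 (M₀ x)))
    (u : Lp H 2 μ) : Tendsto (fun s => (M s).compLpL 2 μ u) l (𝓝 (M₀.compLpL 2 μ u)) := by
  -- Along a sequence, Banach–Steinhaus supplies a uniform bound and dominated convergence applies;
  -- neither is directly available for a general filter.
  refine tendsto_of_seq_tendsto fun s hs => ?_
  have hMs : ∀ x, Tendsto (fun n => M (s n) x) atTop (𝓝 (M₀ x)) := fun x => (hM x).comp hs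
  obtain ⟨C, hC⟩ : ∃ C, ∀ n, ‖M (s n)‖ ≤ C := banach_steinhaus fun x => by
    obtain ⟨C, hC⟩ := (hMs x).norm.bddAbove_range
    exact ⟨C, fun n => hC ⟨n, rfl⟩⟩
  have hu : Integrable (fun t => ‖u t‖ ^ 2) μ :=
    (memLp_two_iff_integrable_sq_norm (Lp.aestronglyMeasurable u)).1 (Lp.memLp u)
  have h1 : Tendsto (fun n => ∫ t, ‖M (s n) (u t) - M₀ (u t)‖ ^ 2 ∂μ) atTop
      (𝓝 (∫ _, (0 : ℝ) ∂μ)) := by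
    refine tendsto_integral_of_dominated_convergence
      (fun t => (C + ‖M₀‖) ^ 2 * ‖u t‖ ^ 2) (fun n => ?_) (hu.const_mul _) (fun n => ?_) ?_
    · have hu' := Lp.aestronglyMeasurable u
      exact ((((M (s n)).continuous.comp_aestronglyMeasurable hu').sub
        (M₀.continuous.comp_aestronglyMeasurable hu')).norm.pow 2)
    · refine Eventually.of_forall fun t => ?_
      rw [Real.norm_of_nonneg (by positivity), ← mul_pow]
      gcongr
      rw [add_mul]
      exact (norm_sub_le _ _).trans
        (add_le_add ((M (s n)).le_of_opNorm_le (hC n) _) (M₀.le_opNorm _))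
    · refine Eventually.of_forall fun t => ?_
      have h := ((hMs (u t)).sub_const (M₀ (u t))).norm.pow 2
      simpa using h
  rw [tendsto_iff_norm_sub_tendsto_zero]
  have h2 : ∀ n, ‖(M (s n)).compLpL 2 μ u - M₀.compLpL 2 μ u‖ =
      √(∫ t, ‖M (s n) (u t) - M₀ (u t)‖ ^ 2 ∂μ) := by
    intro n
    rw [← Real.sqrt_sq (norm_nonneg _), norm_sq_L2]
    congr 1
    refine integral_congr_ae ?_
    filter_upwards [Lp.coeFn_sub ((M (s n)).compLpL 2 μ u) (M₀.compLpL 2 μ u),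
      (M (s n)).coeFn_compLpL u, M₀.coeFn_compLpL u] with t e1 e2 e3
    rw [e1, Pi.sub_apply, e2, e3]
  simp only [Function.comp_apply, h2]
  have h3 := (Real.continuous_sqrt.tendsto _).comp h1
  rw [integral_zero, Real.sqrt_zero] at h3
  exact h3

end Pointwise

/-! ### Graph of the evolutionary operator, and the abstract convergence theorem -/

section Evolution

variable {X Y : Type*} [NormedAddCommGroup X] [InnerProductSpace ℂ X]
  [NormedAddCommGroup Y] [InnerProductSpace ℂ Y]

lemma mem_compBounded_graph {T : Y →ₗ.[ℂ] Y} {M : X →L[ℂ] Y} {x : X} {y : Y} :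
    (x, y) ∈ (compBounded T M).graph ↔ (M x, y) ∈ T.graph := by
  rw [LinearPMap.mem_graph_iff, LinearPMap.mem_graph_iff]
  constructor
  · rintro ⟨z, rfl, h⟩
    exact ⟨⟨M z, z.2⟩, rfl, h⟩
  · rintro ⟨⟨z, hz⟩, h1, h⟩
    dsimp only at h1
    subst h1
    exact ⟨⟨x, hz⟩, rfl, h⟩

lemma mem_add_graph {S T : X →ₗ.[ℂ] Y} {x : X} {y : Y} :
    (x, y) ∈ (S + T).graph ↔ ∃ a b, (x, a) ∈ S.graph ∧ (x, b) ∈ T.graph ∧ y = a + b := by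
  constructor
  · intro h
    obtain ⟨z, rfl, rfl⟩ := (LinearPMap.mem_graph_iff _).1 h
    exact ⟨_, _, S.mem_graph ⟨z, z.2.1⟩, T.mem_graph ⟨z, z.2.2⟩, LinearPMap.add_apply _ _ _⟩
  · rintro ⟨a, b, ha, hb, rfl⟩
    rw [LinearPMap.mem_graph_iff] at ha hb ⊢
    obtain ⟨⟨z, hz⟩, rfl, rfl⟩ := ha
    obtain ⟨⟨z', hz'⟩, h, rfl⟩ := hb
    dsimp only at h
    subst h
    exact ⟨⟨z', hz, hz'⟩, rfl, LinearPMap.add_apply _ _ _⟩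

variable {ρ c : ℝ} {H : Type*} [NormedAddCommGroup H] [InnerProductSpace ℂ H]

lemma timeLift_graph (A : H →ₗ.[ℂ] H) : (timeLift ρ A).graph = timeLiftGraph ρ A := by
  refine Submodule.toLinearPMap_graph_eq _ ?_
  rintro ⟨u, v⟩ h hu
  obtain rfl : u = 0 := hu
  refine Lp.eq_zero_iff_ae_eq_zero.2 ?_
  filter_upwards [h, Lp.coeFn_zero H 2 (timeMeasure ρ)] with t h1 h2
  exact A.graph_fst_eq_zero_snd h1 h2

/-- The pointwise resolvent condition becomes one equation for a bounded operator on functions of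
time, as the abstract theory requires. -/
lemma mem_timeLift_graph {A : H →ₗ.[ℂ] H} {J : H →L[ℂ] H}
    (hJ : ∀ x y, (x, y) ∈ A.graph ↔ J (x + y) = x) {u v : HRho ρ H} :
    (u, v) ∈ (timeLift ρ A).graph ↔ J.compLpL 2 (timeMeasure ρ) (u + v) = u := by
  rw [timeLift_graph]
  change (∀ᵐ t ∂timeMeasure ρ, (u t, v t) ∈ A.graph) ↔ _
  rw [Lp.ext_iff]
  refine eventually_congr ?_
  filter_upwards [J.coeFn_compLpL (u + v), Lp.coeFn_add u v] with t h1 h2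
  rw [h1, h2, hJ]
  rfl

lemma mem_evolutionOp_graph {M N : H →L[ℂ] H} {A : H →ₗ.[ℂ] H} {u f : HRho ρ H} :
    (u, f) ∈ (evolutionOp ρ M N A).graph ↔ ∃ d a,
      (M.compLpL 2 (timeMeasure ρ) u, d) ∈ (timeDeriv ρ H).graph ∧
      (u, a) ∈ (timeLift ρ A).graph ∧ f = d + N.compLpL 2 (timeMeasure ρ) u + a := by
  rw [evolutionOp, mem_add_graph]
  constructor
  · rintro ⟨b, a, hb, ha, rfl⟩
    obtain ⟨d, e, hd, he, rfl⟩ := mem_add_graph.1 hb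
    refine ⟨d, a, mem_compBounded_graph.1 hd, ha, ?_⟩
    rw [LinearPMap.mem_graph_iff] at he
    obtain ⟨z, rfl, rfl⟩ := he
    rfl
  · rintro ⟨d, a, hd, ha, rfl⟩
    refine ⟨_, a, mem_add_graph.2 ⟨d, _, mem_compBounded_graph.2 hd, ?_, rfl⟩, ha, rfl⟩
    rw [LinearPMap.mem_graph_iff]
    exact ⟨⟨u, trivial⟩, rfl, rfl⟩

variable [CompleteSpace H]

/-- Well-posedness of evolutionary equations, and strong convergence of the solution operators. -/
theorem solutionOperatorsConverge_of_isSkewSelfAdjoint {A : H →ₗ.[ℂ] H}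
    (hA : IsSkewSelfAdjoint A) {M N : ℝ → H →L[ℂ] H} (hρ : 0 < ρ) (hc : 0 < c)
    (hM : ∀ s ∈ Set.Ico (0 : ℝ) 1, IsSelfAdjoint (M s))
    (hge : ∀ s ∈ Set.Ico (0 : ℝ) 1, ReGE ((ρ : ℂ) • M s + N s) c)
    (hMt : ∀ x, Tendsto (fun s => M s x) (𝓝[>] 0) (𝓝 (M 0 x)))
    (hNt : ∀ x, Tendsto (fun s => N s x) (𝓝[>] 0) (𝓝 (N 0 x))) :
    SolutionOperatorsConverge ρ M N A c := by
  obtain ⟨J, hJ, hJA⟩ := hA.exists_resolvent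
  obtain ⟨P, R, W, hP, hPD, hR, hRW, hRP, hL⟩ := exists_timeDeriv_inverse (ρ := ρ) (H := H) hρ
  have hJ' : IsNormalInverse 2 (J.compLpL 2 (timeMeasure ρ)) := hJ.compLpL
  have hge' : ∀ s ∈ Set.Ico (0 : ℝ) 1, ReGE ((ρ : ℂ) • (M s).compLpL 2 (timeMeasure ρ) +
      (N s).compLpL 2 (timeMeasure ρ)) c := fun s hs => by
    rw [← ContinuousLinearMap.smul_compLpL, ← ContinuousLinearMap.add_compLpL]
    exact (hge s hs).compLpL
  have hsolv : ∀ s : ℝ, ∃ S : HRho ρ H →L[ℂ] HRho ρ H, s ∈ Set.Ico (0 : ℝ) 1 →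
      (evolutionOp ρ (M s) (N s) A).IsClosable ∧
      IsBoundedInverse (evolutionOp ρ (M s) (N s) A).closure S ∧ ‖S‖ ≤ 1 / c ∧
      ∀ z, S (coreValue P (J.compLpL 2 (timeMeasure ρ)) ((M s).compLpL 2 (timeMeasure ρ))
        ((N s).compLpL 2 (timeMeasure ρ)) z) = P (J.compLpL 2 (timeMeasure ρ) z) := by
    intro s
    by_cases hs : s ∈ Set.Ico (0 : ℝ) 1
    · obtain ⟨h1, S, h2, h3, h4⟩ := evolution_solvable hc hP hJ' (isSelfAdjoint_compLpL (hM s hs))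
        (hL _).1 (hL _).1 (hL _).1 (hge' s hs) hR hRW hRP (hL _).2
        (T := evolutionOp ρ (M s) (N s) A) (fun u f => by
          rw [mem_evolutionOp_graph]
          simp only [hPD, mem_timeLift_graph hJA])
      exact ⟨S, fun _ => ⟨h1, h2, h3, h4⟩⟩
    -- Nothing is required outside `[0, 1)`; zero is a default that makes the family total.
    · exact ⟨0, fun h => absurd h hs⟩
  choose S hS using hsolv
  have h0 : (0 : ℝ) ∈ Set.Ico (0 : ℝ) 1 := ⟨le_rfl, one_pos⟩
  refine ⟨S, fun s hs => ⟨(hS s hs).1, (hS s hs).2.1, (hS s hs).2.2.1⟩, fun F => ?_⟩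
  refine evolution_tendsto hc hP hJ' (isSelfAdjoint_compLpL (hM 0 h0)) (hL _).1 (hge' 0 h0) ?_
    (hS 0 h0).2.2.1 (hS 0 h0).2.2.2 (tendsto_compLpL hMt) (tendsto_compLpL hNt) F
  filter_upwards [Ioo_mem_nhdsGT (one_pos (α := ℝ))] with s hs
  exact (hS s ⟨hs.1.le, hs.2⟩).2.2

end Evolution

/-! ### Skew-selfadjointness of off-diagonal block operators -/

section SkewBlock

variable {X : Type*} [NormedAddCommGroup X] [InnerProductSpace ℂ X] [CompleteSpace X]

/-- A closed graph is its own double adjoint. -/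
lemma mem_of_mem_adjoint_adjoint {G : Submodule ℂ (X × X)} (hG : IsClosed (G : Set (X × X)))
    {x w : X} (h : (x, w) ∈ G.adjoint.adjoint) : (x, w) ∈ G := by
  rw [Submodule.mem_adjoint_iff] at h
  -- The adjoint graph is the orthogonal complement rotated by a quarter turn, so the claim reduces
  -- to `G'ᗮᗮ = G'`. This needs the Hilbert norm on the product in place of the supremum norm.
  let G' : Submodule ℂ (WithLp 2 (X × X)) :=
    G.comap (WithLp.linearEquiv 2 ℂ (X × X) : WithLp 2 (X × X) →ₗ[ℂ] X × X)
  have hG' : IsClosed (G' : Set (WithLp 2 (X × X))) :=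
    hG.preimage (WithLp.prod_continuous_ofLp 2 X X)
  have : CompleteSpace G' := hG'.completeSpace_coe
  suffices WithLp.toLp 2 (x, w) ∈ G'ᗮᗮ by
    rw [Submodule.orthogonal_orthogonal] at this
    exact this
  rw [Submodule.mem_orthogonal]
  intro v hv
  rw [Submodule.mem_orthogonal] at hv
  have h1 := h v.snd (-v.fst) (by
    rw [Submodule.mem_adjoint_iff]
    intro a b hab
    have h2 := hv (WithLp.toLp 2 (a, b)) hab
    rw [WithLp.prod_inner_apply] at h2
    dsimp at h2 ⊢
    rw [inner_neg_right, sub_neg_eq_add, add_comm]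
    exact h2)
  rw [WithLp.prod_inner_apply]
  rw [inner_neg_left] at h1
  dsimp at h1 ⊢
  linear_combination -h1

lemma mem_skewBlock_graph {C : X →ₗ.[ℂ] X} {p q : WithLp 2 (X × X)} :
    (p, q) ∈ (skewBlock C).graph ↔
      (p.fst, q.snd) ∈ C.graph ∧ (p.snd, -q.fst) ∈ C†.graph := by
  simp only [LinearPMap.mem_graph_iff]
  constructor
  · rintro ⟨z, rfl, rfl⟩
    exact ⟨⟨⟨z.1.fst, z.2.1⟩, rfl, rfl⟩, ⟨⟨z.1.snd, z.2.2⟩, rfl, (neg_neg _).symm⟩⟩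
  · rintro ⟨⟨⟨a, ha⟩, h1, h2⟩, ⟨⟨b, hb⟩, h3, h4⟩⟩
    dsimp only at h1 h3
    subst h1 h3
    refine ⟨⟨p, ha, hb⟩, rfl, ?_⟩
    rw [← neg_eq_iff_eq_neg] at h4
    change WithLp.toLp 2 (-(C† ⟨p.snd, hb⟩), C ⟨p.fst, ha⟩) = q
    rw [h2, h4]
    rfl

/-- The off-diagonal block operator of a closed densely defined operator is skew-selfadjoint. -/
theorem isSkewSelfAdjoint_skewBlock {C : X →ₗ.[ℂ] X} (hC : Dense (C.domain : Set X))
    (hC' : Dense (C†.domain : Set X)) (hcl : C.IsClosed) : IsSkewSelfAdjoint (skewBlock C) := by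
  have hdense : Dense ((skewBlock C).domain : Set (WithLp 2 (X × X))) :=
    (hC.prod hC').preimage
      (WithLp.prodContinuousLinearEquiv 2 ℂ X X).toHomeomorph.isOpenMap
  refine ⟨hdense, LinearPMap.eq_of_eq_graph ?_⟩
  ext ⟨x, z⟩
  rw [mem_neg_graph_iff, mem_skewBlock_graph, LinearPMap.adjoint_graph_eq_graph_adjoint hdense,
    Submodule.mem_adjoint_iff]
  simp only [WithLp.neg_fst, WithLp.neg_snd, neg_neg, WithLp.prod_inner_apply]
  constructor
  · intro h
    constructor
    -- Testing with pairs `(0, a)` isolates the component governed by `C**`, which equals `C`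
    -- because `C` is closed; pairs `(a, 0)` give the `C*` component below.
    · refine mem_of_mem_adjoint_adjoint hcl ?_
      rw [Submodule.mem_adjoint_iff]
      intro a b hab
      rw [← LinearPMap.adjoint_graph_eq_graph_adjoint hC] at hab
      have h1 := h (WithLp.toLp 2 (0, a)) (WithLp.toLp 2 (-b, 0)) (mem_skewBlock_graph.2
        ⟨C.graph.zero_mem, by simpa using hab⟩)
      simp at h1
      rw [inner_neg_right]
      linear_combination -h1
    · rw [LinearPMap.adjoint_graph_eq_graph_adjoint hC, Submodule.mem_adjoint_iff]
      intro a b hab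
      have h1 := h (WithLp.toLp 2 (a, 0)) (WithLp.toLp 2 (0, b)) (mem_skewBlock_graph.2
        ⟨hab, by simp⟩)
      simp at h1
      exact h1
  · rintro ⟨h1, h2⟩ p q hpq
    obtain ⟨h3, h4⟩ := mem_skewBlock_graph.1 hpq
    rw [LinearPMap.adjoint_graph_eq_graph_adjoint hC, Submodule.mem_adjoint_iff] at h2 h4
    have e1 := h2 _ _ h3
    have e2 := congrArg (starRingEnd ℂ) (h4 _ _ h1)
    simp only [inner_neg_right, inner_neg_left, map_sub, map_neg, inner_conj_symm, map_zero] at e1 e2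
    dsimp at e1 e2 ⊢
    linear_combination e1 + e2

end SkewBlock

/-! ### The curl and the Maxwell operator -/

section Curl

/-- The sesquilinear form `(u, v) ↦ conj (uᵢ) vₖ` on `ℂ³`. -/
def coordForm (i k : Fin 3) : C3 →L[ℝ] C3 →L[ℝ] ℂ :=
  (ContinuousLinearMap.mul ℝ ℂ).bilinearComp
    ((Complex.conjCLE : ℂ →L[ℝ] ℂ).comp ((EuclideanSpace.proj i : C3 →L[ℂ] ℂ).restrictScalars ℝ))
    ((EuclideanSpace.proj k : C3 →L[ℂ] ℂ).restrictScalars ℝ)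

lemma coordForm_apply (i k : Fin 3) (u v : C3) :
    coordForm i k u v = starRingEnd ℂ (u i) * v k := rfl

variable {φ ψ : R3 → C3}

lemma continuous_pderiv (hφ : ContDiff ℝ 1 φ) (j i : Fin 3) : Continuous (pderiv j i φ) := by
  have h := hφ.continuous_fderiv one_ne_zero
  unfold pderiv
  fun_prop

lemma integrable_conj_mul_pderiv (hφ : ContDiff ℝ 1 φ) (hφc : HasCompactSupport φ)
    (hψ : ContDiff ℝ 1 ψ) (i j k : Fin 3) :
    Integrable fun x => starRingEnd ℂ (φ x i) * pderiv j k ψ x := by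
  have h1 := hφ.continuous
  have h2 := continuous_pderiv hψ j k
  refine Continuous.integrable_of_hasCompactSupport (by fun_prop) (hφc.mono fun x hx h => hx ?_)
  simp [h]

lemma integrable_conj_pderiv_mul (hφ : ContDiff ℝ 1 φ) (hψ : ContDiff ℝ 1 ψ)
    (hψc : HasCompactSupport ψ) (i j k : Fin 3) :
    Integrable fun x => starRingEnd ℂ (pderiv j i φ x) * ψ x k := by
  have h1 := hψ.continuous
  have h2 := continuous_pderiv hφ j i
  refine Continuous.integrable_of_hasCompactSupport (by fun_prop) (hψc.mono fun x hx h => hx ?_)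
  simp [h]

lemma integral_conj_pderiv_mul (hφ : ContDiff ℝ 1 φ) (hφc : HasCompactSupport φ)
    (hψ : ContDiff ℝ 1 ψ) (hψc : HasCompactSupport ψ) (i j k : Fin 3) :
    ∫ x, starRingEnd ℂ (pderiv j i φ x) * ψ x k =
      -∫ x, starRingEnd ℂ (φ x i) * pderiv j k ψ x := by
  have h1 := hφ.continuous
  have h2 := hψ.continuous
  have h := integral_bilinear_fderiv_right_eq_neg_left_of_integrable (μ := volume)
    (B := coordForm i k) (f := φ) (g := ψ) (v := EuclideanSpace.single j 1)
    (integrable_conj_pderiv_mul hφ hψ hψc i j k) (integrable_conj_mul_pderiv hφ hφc hψ i j k)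
    (by
      simp only [coordForm_apply]
      refine Continuous.integrable_of_hasCompactSupport (by fun_prop)
        (hφc.mono fun x hx h => hx ?_)
      simp [h])
    (fun x _ => hφ.differentiable one_ne_zero x) (fun x _ => hψ.differentiable one_ne_zero x)
  exact (neg_eq_iff_eq_neg.2 h).symm

lemma integral_curl_sum {f₁ f₂ f₃ f₄ f₅ f₆ : R3 → ℂ} (h₁ : Integrable f₁) (h₂ : Integrable f₂)
    (h₃ : Integrable f₃) (h₄ : Integrable f₄) (h₅ : Integrable f₅) (h₆ : Integrable f₆) :
    ∫ x, ((f₁ x - f₂ x) + (f₃ x - f₄ x) + (f₅ x - f₆ x)) =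
      ((∫ x, f₁ x) - ∫ x, f₂ x) + ((∫ x, f₃ x) - ∫ x, f₄ x) + ((∫ x, f₅ x) - ∫ x, f₆ x) := by
  refine (integral_add ((h₁.sub h₂).add (h₃.sub h₄)) (h₅.sub h₆)).trans ?_
  rw [integral_add' (h₁.sub h₂) (h₃.sub h₄), integral_sub' h₁ h₂, integral_sub' h₃ h₄,
    integral_sub' h₅ h₆]

/-- The classical curl is symmetric on compactly supported fields. -/
lemma integral_inner_classicalCurl (hφ : ContDiff ℝ 1 φ) (hφc : HasCompactSupport φ)
    (hψ : ContDiff ℝ 1 ψ) (hψc : HasCompactSupport ψ) :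
    ∫ x, (inner ℂ (classicalCurl φ x) (ψ x) : ℂ) = ∫ x, (inner ℂ (φ x) (classicalCurl ψ x) : ℂ) := by
  have e1 : ∀ x, (inner ℂ (classicalCurl φ x) (ψ x) : ℂ) =
      (starRingEnd ℂ (pderiv 1 2 φ x) * ψ x 0 - starRingEnd ℂ (pderiv 2 1 φ x) * ψ x 0) +
      (starRingEnd ℂ (pderiv 2 0 φ x) * ψ x 1 - starRingEnd ℂ (pderiv 0 2 φ x) * ψ x 1) +
      (starRingEnd ℂ (pderiv 0 1 φ x) * ψ x 2 - starRingEnd ℂ (pderiv 1 0 φ x) * ψ x 2) := by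
    intro x
    simp only [PiLp.inner_apply, Fin.sum_univ_three, classicalCurl, RCLike.inner_apply]
    simp
    ring
  have e2 : ∀ x, (inner ℂ (φ x) (classicalCurl ψ x) : ℂ) =
      (starRingEnd ℂ (φ x 0) * pderiv 1 2 ψ x - starRingEnd ℂ (φ x 0) * pderiv 2 1 ψ x) +
      (starRingEnd ℂ (φ x 1) * pderiv 2 0 ψ x - starRingEnd ℂ (φ x 1) * pderiv 0 2 ψ x) +
      (starRingEnd ℂ (φ x 2) * pderiv 0 1 ψ x - starRingEnd ℂ (φ x 2) * pderiv 1 0 ψ x) := by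
    intro x
    simp only [PiLp.inner_apply, Fin.sum_univ_three, classicalCurl, RCLike.inner_apply]
    simp
    ring
  have a := fun i j k => integrable_conj_pderiv_mul hφ hψ hψc i j k
  have b := fun i j k => integrable_conj_mul_pderiv hφ hφc hψ i j k
  simp_rw [e1, e2]
  -- In `a i j k` and `b i j k` the derivative `∂ⱼ` falls on `φᵢ` and on `ψₖ` respectively.
  -- Integration by parts turns each `a i j k` into `-b i j k`, and the signs match after permuting
  -- the six terms.
  refine (integral_curl_sum (a 2 1 0) (a 1 2 0) (a 0 2 1) (a 2 0 1) (a 1 0 2) (a 0 1 2)).trans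
    (Eq.trans ?_ (integral_curl_sum (b 0 1 2) (b 0 2 1) (b 1 2 0) (b 1 0 2) (b 2 0 1)
      (b 2 1 0)).symm)
  simp only [integral_conj_pderiv_mul hφ hφc hψ hψc]
  ring

variable {Ω : Set R3}

/-- Both fields are supported inside `Ω`, so the integrals extend to the whole space and no boundary
term or boundary regularity enters. -/
lemma curlGraph_inner {p q : L2C3 Ω × L2C3 Ω} (hp : p ∈ curlGraph Ω) (hq : q ∈ curlGraph Ω) :
    (inner ℂ p.2 q.1 : ℂ) = inner ℂ p.1 q.2 := by
  obtain ⟨φ, hφ, hφc, hφs, h1, h2⟩ := hp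
  obtain ⟨ψ, hψ, hψc, hψs, h3, h4⟩ := hq
  have s1 : ∫ x in Ω, (inner ℂ (classicalCurl φ x) (ψ x) : ℂ) =
      ∫ x, (inner ℂ (classicalCurl φ x) (ψ x) : ℂ) :=
    setIntegral_eq_integral_of_forall_compl_eq_zero fun x hx => by
      rw [image_eq_zero_of_notMem_tsupport fun h => hx (hψs h), inner_zero_right]
  have s2 : ∫ x in Ω, (inner ℂ (φ x) (classicalCurl ψ x) : ℂ) =
      ∫ x, (inner ℂ (φ x) (classicalCurl ψ x) : ℂ) :=
    setIntegral_eq_integral_of_forall_compl_eq_zero fun x hx => by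
      rw [image_eq_zero_of_notMem_tsupport fun h => hx (hφs h), inner_zero_left]
  have e1 : (inner ℂ p.2 q.1 : ℂ) = ∫ x, (inner ℂ (classicalCurl φ x) (ψ x) : ℂ) := by
    rw [L2.inner_def, ← s1]
    refine integral_congr_ae ?_
    filter_upwards [h2, h3] with x h5 h6
    rw [h5, h6]
  have e2 : (inner ℂ p.1 q.2 : ℂ) = ∫ x, (inner ℂ (φ x) (classicalCurl ψ x) : ℂ) := by
    rw [L2.inner_def, ← s2]
    refine integral_congr_ae ?_
    filter_upwards [h1, h4] with x h5 h6
    rw [h5, h6]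
  rw [e1, e2, integral_inner_classicalCurl hφ hφc hψ hψc]

lemma curlGraph_closure_inner {p q : L2C3 Ω × L2C3 Ω} (hp : p ∈ (curlGraph Ω).topologicalClosure)
    (hq : q ∈ curlGraph Ω) : (inner ℂ p.2 q.1 : ℂ) = inner ℂ p.1 q.2 :=
  closure_minimal (t := {p : L2C3 Ω × L2C3 Ω | (inner ℂ p.2 q.1 : ℂ) = inner ℂ p.1 q.2})
    (fun _ hp => curlGraph_inner hp hq) (isClosed_eq (by fun_prop) (by fun_prop)) hp

lemma exists_mem_curlGraph {φ : R3 → C3} (hφ : ContDiff ℝ 1 φ) (hφc : HasCompactSupport φ)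
    (hφs : tsupport φ ⊆ Ω) : ∃ p ∈ curlGraph Ω, p.1 =ᵐ[volume.restrict Ω] φ := by
  have h1 : MemLp φ 2 (volume.restrict Ω) := hφ.continuous.memLp_of_hasCompactSupport hφc
  have hcurl : Continuous (classicalCurl φ) := by
    have h := fun j i => continuous_pderiv hφ j i
    refine (PiLp.continuous_toLp 2 _).comp (continuous_pi fun i => ?_)
    fin_cases i
    · exact (h 1 2).sub (h 2 1)
    · exact (h 2 0).sub (h 0 2)
    · exact (h 0 1).sub (h 1 0)
  have hcurlc : HasCompactSupport (classicalCurl φ) := by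
    refine (hφc.fderiv (𝕜 := ℝ)).mono fun x hx h => hx ?_
    ext i
    fin_cases i <;> simp [classicalCurl, pderiv, h]
  have h2 : MemLp (classicalCurl φ) 2 (volume.restrict Ω) :=
    hcurl.memLp_of_hasCompactSupport hcurlc
  exact ⟨(h1.toLp, h2.toLp), ⟨φ, hφ, hφc, hφs, h1.coeFn_toLp, h2.coeFn_toLp⟩, h1.coeFn_toLp⟩

/-- Compactly supported `C¹` fields are dense in `L²(Ω, ℂ³)`. -/
lemma dense_curlGraph_fst (hΩ : IsOpen Ω) :
    Dense (Prod.fst '' (curlGraph Ω : Set (L2C3 Ω × L2C3 Ω))) := by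
  have himg : Prod.fst '' (curlGraph Ω : Set (L2C3 Ω × L2C3 Ω)) =
      ((curlGraph Ω).map (LinearMap.fst ℂ _ _) : Set (L2C3 Ω)) := rfl
  rw [himg, Submodule.dense_iff_topologicalClosure_eq_top,
    Submodule.topologicalClosure_eq_top_iff, Submodule.eq_bot_iff]
  intro g hg
  rw [Submodule.mem_orthogonal] at hg
  have hg1 : LocallyIntegrable g (volume.restrict Ω) :=
    (Lp.memLp g).locallyIntegrable (by norm_num)
  have h0 := hΩ.ae_eq_zero_of_integral_contDiff_smul_eq_zero (μ := volume) (f := g)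
    (locallyIntegrableOn_of_locallyIntegrable_restrict hg1) (by
      intro η hη hηc hηs
      have hη' := hη.continuous
      have hsupp : ∀ x, x ∉ Ω → η x • g x = 0 := fun x hx => by
        rw [image_eq_zero_of_notMem_tsupport fun h => hx (hηs h), zero_smul]
      rw [← setIntegral_eq_integral_of_forall_compl_eq_zero hsupp]
      have hint : Integrable (fun x => η x • g x) (volume.restrict Ω) :=
        hg1.integrable_smul_left_of_hasCompactSupport hη' hηc
      -- A vector-valued integral vanishes if its inner product with every constant `c` does; the
      -- latter is orthogonality of `g` to the test field `η c`.
      refine integral_eq_zero_of_forall_integral_inner_eq_zero ℂ _ hint fun c => ?_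
      have hη1 : ContDiff ℝ 1 η := hη.of_le (by exact_mod_cast le_top)
      obtain ⟨p, hp, hpφ⟩ := exists_mem_curlGraph (Ω := Ω) (φ := fun x => η x • c)
        (hη1.smul contDiff_const) (hηc.smul_right (f' := fun _ => c))
        ((tsupport_smul_subset_left η fun _ => c).trans hηs)
      have h := hg p.1 ⟨p, hp, rfl⟩
      rw [L2.inner_def] at h
      rw [← h]
      refine integral_congr_ae ?_
      filter_upwards [hpφ] with x hx
      rw [hx, ← Complex.coe_smul, ← Complex.coe_smul, inner_smul_left, inner_smul_right,
        Complex.conj_ofReal])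
  rw [Lp.eq_zero_iff_ae_eq_zero]
  exact (ae_restrict_iff' hΩ.measurableSet).2 h0

/-- A densely defined symmetric operator is closable: a limit pair `(0, y)` has `y` orthogonal to
the dense domain. -/
lemma curl0_graph (hΩ : IsOpen Ω) : (curl0 Ω).graph = (curlGraph Ω).topologicalClosure := by
  refine graph_closure_toLinearPMap ?_
  rintro ⟨x, y⟩ hp hx
  obtain rfl : x = 0 := hx
  refine (dense_curlGraph_fst hΩ).eq_zero_of_inner_left ℂ ?_
  rintro _ ⟨q, hq, rfl⟩
  rw [curlGraph_closure_inner hp hq, inner_zero_left]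

/-- The Maxwell operator on an arbitrary open set is skew-selfadjoint. -/
theorem isSkewSelfAdjoint_maxwellOp (hΩ : IsOpen Ω) : IsSkewSelfAdjoint (maxwellOp Ω) := by
  have hsub : ∀ p ∈ curlGraph Ω, p ∈ (curl0 Ω).graph := fun p hp => by
    rw [curl0_graph hΩ]
    exact Submodule.le_topologicalClosure _ hp
  have hdom : Dense ((curl0 Ω).domain : Set (L2C3 Ω)) := by
    refine (dense_curlGraph_fst hΩ).mono ?_
    rintro _ ⟨p, hp, rfl⟩
    exact LinearPMap.mem_domain_of_mem_graph (hsub p hp)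
  refine isSkewSelfAdjoint_skewBlock hdom ?_ ?_
  -- By symmetry the test fields also belong to the domain of the adjoint, which is therefore dense.
  · refine (dense_curlGraph_fst hΩ).mono ?_
    rintro _ ⟨q, hq, rfl⟩
    refine LinearPMap.mem_domain_of_mem_graph (y := q.2) ?_
    rw [LinearPMap.adjoint_graph_eq_graph_adjoint hdom, Submodule.mem_adjoint_iff]
    intro a b hab
    rw [curl0_graph hΩ] at hab
    rw [curlGraph_closure_inner hab hq, sub_self]
  · rw [LinearPMap.IsClosed, curl0_graph hΩ]
    exact Submodule.isClosed_topologicalClosure _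

end Curl

end EddyCurrent

end

theorem mainTheorem1 (Ω : Set R3) (hΩ : IsOpen Ω) :
    -- the Maxwell operator is skew-selfadjoint
    IsSkewSelfAdjoint (maxwellOp Ω) ∧
    -- classical electrodynamics: `M_s = diag(ε_s, μ_s)` and `N_s = diag(σ_s, 0)`
    (∀ (ε μ σ : ℝ → L2C3 Ω →L[ℂ] L2C3 Ω) (ρ c : ℝ), 0 < ρ → 0 < c →
      (∀ s ∈ Set.Ico (0 : ℝ) 1, IsSelfAdjoint (blockDiag (ε s) (μ s))) →
      (∀ s ∈ Set.Ico (0 : ℝ) 1,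
        ReGE ((ρ : ℂ) • blockDiag (ε s) (μ s) + blockDiag (σ s) 0) c) →
      (∀ x : L2C6 Ω, Tendsto (fun s => blockDiag (ε s) (μ s) x) (𝓝[>] 0)
        (𝓝 (blockDiag (ε 0) (μ 0) x))) →
      (∀ x : L2C6 Ω, Tendsto (fun s => blockDiag (σ s) 0 x) (𝓝[>] 0)
        (𝓝 (blockDiag (σ 0) 0 x))) →
      SolutionOperatorsConverge ρ (fun s => blockDiag (ε s) (μ s))
        (fun s => blockDiag (σ s) 0) (maxwellOp Ω) c) ∧
    -- general bounded coefficient operators `M_s = M_s*` and `N_s`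
    (∀ (M N : ℝ → L2C6 Ω →L[ℂ] L2C6 Ω) (ρ c : ℝ), 0 < ρ → 0 < c →
      (∀ s ∈ Set.Ico (0 : ℝ) 1, IsSelfAdjoint (M s)) →
      (∀ s ∈ Set.Ico (0 : ℝ) 1, ReGE ((ρ : ℂ) • M s + N s) c) →
      (∀ x : L2C6 Ω, Tendsto (fun s => M s x) (𝓝[>] 0) (𝓝 (M 0 x))) →
      (∀ x : L2C6 Ω, Tendsto (fun s => N s x) (𝓝[>] 0) (𝓝 (N 0 x))) →
      SolutionOperatorsConverge ρ M N (maxwellOp Ω) c) := by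
  -- Skew-selfadjointness is all that is used about `A`; the block-diagonal coefficients are an
  -- instance of the general ones.
  have hA := isSkewSelfAdjoint_maxwellOp hΩ
  refine ⟨hA, fun ε μ σ ρ c hρ hc hM hge hMt hNt => ?_, fun M N ρ c hρ hc hM hge hMt hNt => ?_⟩
  · exact solutionOperatorsConverge_of_isSkewSelfAdjoint hA hρ hc hM hge hMt hNt
  · exact solutionOperatorsConverge_of_isSkewSelfAdjoint hA hρ hc hM hge hMt hNt
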